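/- **Holevo–Schumacher–Westmoreland Theorem.** Let $\Phi$ be a quantum channel, i.e. a completely positive, trace preserving linear map from the complex $d_A\times d_A$ matrices to the complex $d_B\times d_B$ matrices ($d_A\ge 1$). Logarithms are in base $2$, and $S(\varrho)=-\mathrm{Tr}(\varrho\log\varrho)$ is the von Neumann entropy of a density operator (a positive semidefinite matrix of trace one). Fix a family $(\varrho_i)_{i\in I}$ of density operators on $\mathbb{C}^{d_A}$, the input states. A code of block length $m$ with $N$ messages consists of a word $(i_1,\dots,i_m)\in I^m$ for each message $w\in\{1,\dots,N\}$, which is sent as $\varrho_w=\varrho_{i_1}\otimes\cdots\otimes\varrho_{i_m}$ and received as $\sigma_w=\Phi^{\otimes m}(\varrho_w)$, and of positive semidefinite operators $M_1,\dots,M_N$ on $(\mathbb{C}^{d_B})^{\otimes m}$ with $\sum_w M_w=\mathbf 1$ (the decoder, a joint measurement of the $m$ outputs). Its error probability is $p_e=\frac1N\sum_{w=1}^{N}\bigl(1-\mathrm{Tr}(\sigma_wM_w)\bigr)$. Information can be transmitted reliably at rate $R\ge 0$ if there are codes of every block length $m$, with $N_m$ messages, such that $\frac1m\log N_m\to R$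 and $p_e\to0$ as $m\to\infty$. Say that $C\in\mathbb{R}$ is the capacity for the input states $(\varrho_i)_{i\in I}$ if 1. for every $R\ge0$, information can be transmitted reliably at rate $R$ if and only if $R\le C$; 2. for every $R<C$ there are codes of every block length $m$ with exactly $\lceil 2^{mR}\rceil$ messages and with $p_e\to0$ as $m\to\infty$; 3. for every $R>C$ there is $\delta>0$ such that, for all large $m$, every code of block length $m$ with at least $2^{mR}$ messages has $p_e\ge\delta$. Then: (a) For every finite nonempty family $\varrho_1,\dots,\varrho_n$ of input states, the maximum $$C=\max_{p}\Bigl[S\Bigl(\Phi\Bigl(\sum_{i=1}^n p_i\varrho_i\Bigr)\Bigr)-\sum_{i=1}^n p_i\,S(\Phi(\varrho_i))\Bigr]$$ over all probability distributions $p=(p_1,\dots,p_n)$ exists, and it is the capacity for the input states $\varrho_1,\dots,\varrho_n$. (b) The maximum of the same expression over all $n$, all density operators $\varrho_1,\dots,\varrho_n$ on $\mathbb{C}^{d_A}$ and all probability distributions $p$ exists, and it is the capacity when all density operators on $\mathbb{C}^{d_A}$ are allowed as input states (so that the codewords are arbitrary product states). -/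

import Mathlib

open Filter Topology
open scoped Matrix ComplexOrder

noncomputable section

/-- A state (density operator) of a quantum system with Hilbert space `ℂ^a`: a positive
semidefinite matrix of trace one. -/
structure QState (a : Type*) [Fintype a] where
  matrix : Matrix a a ℂ
  posSemidef : matrix.PosSemidef
  trace_eq_one : matrix.trace = 1

/-- The von Neumann entropy `S(ρ) = -Tr (ρ log ρ)` (logarithm in base 2), that is,
`-∑ λ log₂ λ` over the eigenvalues `λ` of `ρ` with multiplicity, with `0 log 0 = 0`. -/
def QState.entropy {a : Type*} [Fintype a] [DecidableEq a] (ρ : QState a) : ℝ :=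
  -∑ i, ρ.posSemidef.isHermitian.eigenvalues i *
    Real.logb 2 (ρ.posSemidef.isHermitian.eigenvalues i)

/-- The average state `∑ pᵢ ρᵢ` of an ensemble. -/
def QState.mix {a ι : Type*} [Fintype a] [Fintype ι] (p : stdSimplex ℝ ι) (ρ : ι → QState a) :
    QState a where
  matrix := ∑ i, (p i : ℂ) • (ρ i).matrix
  posSemidef := Matrix.posSemidef_sum _ fun i _ =>
    (ρ i).posSemidef.smul (by exact_mod_cast p.2.1 i)
  trace_eq_one := by
    have h : ∑ i, p i = 1 := p.2.2
    simp only [Matrix.trace_sum, Matrix.trace_smul, (ρ _).trace_eq_one, smul_eq_mul, mul_one]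
    exact_mod_cast h

/-- The map `id ⊗ Φ` on `k × k` block matrices: `Φ` is applied to each block. -/
def blockApply {a b k : Type*} (Φ : Matrix a a ℂ →ₗ[ℂ] Matrix b b ℂ)
    (X : Matrix (k × a) (k × a) ℂ) : Matrix (k × b) (k × b) ℂ :=
  Matrix.of fun s t => Φ (Matrix.of fun x y => X (s.1, x) (t.1, y)) s.2 t.2

/-- A quantum channel: a completely positive, trace preserving linear map. -/
structure QChannel (a b : Type*) [Fintype a] [Fintype b] where
  map : Matrix a a ℂ →ₗ[ℂ] Matrix b b ℂ
  completelyPositive : ∀ (k : ℕ) (X : Matrix (Fin k × a) (Fin k × a) ℂ),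
    X.PosSemidef → (blockApply map X).PosSemidef
  tracePreserving : ∀ X, (map X).trace = X.trace

/-- The output state `Φ(ρ)`. -/
def QChannel.apply {a b : Type*} [Fintype a] [Fintype b] (Φ : QChannel a b) (ρ : QState a) :
    QState b where
  matrix := Φ.map ρ.matrix
  posSemidef :=
    (Φ.completelyPositive 1 (ρ.matrix.submatrix Prod.snd Prod.snd)
      (ρ.posSemidef.submatrix _)).submatrix fun y : b => ((0 : Fin 1), y)
  trace_eq_one := by rw [Φ.tracePreserving, ρ.trace_eq_one]

/-- The tensor product `X₁ ⊗ ⋯ ⊗ X_m`, an operator on `(ℂ^a)^{⊗m} = ℂ^(a^m)`. -/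
def tensorProd {a : Type*} {m : ℕ} (X : Fin m → Matrix a a ℂ) :
    Matrix (Fin m → a) (Fin m → a) ℂ :=
  Matrix.of fun x y => ∏ j, X j (x j) (y j)

/-- The `m`-fold use `Φ^{⊗m}` of a channel: the linear map that sends the matrix unit
`E_{x₁y₁} ⊗ ⋯ ⊗ E_{x_m y_m}` to `Φ(E_{x₁y₁}) ⊗ ⋯ ⊗ Φ(E_{x_m y_m})`. -/
def QChannel.tensorPow {a b : Type*} [Fintype a] [DecidableEq a] [Fintype b]
    (Φ : QChannel a b) (m : ℕ) :
    Matrix (Fin m → a) (Fin m → a) ℂ →ₗ[ℂ] Matrix (Fin m → b) (Fin m → b) ℂ where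
  toFun X := ∑ x, ∑ y, X x y • tensorProd fun j => Φ.map (Matrix.single (x j) (y j) 1)
  map_add' X Y := by simp only [Matrix.add_apply, add_smul, Finset.sum_add_distrib]
  map_smul' c X := by
    simp only [Matrix.smul_apply, smul_eq_mul, mul_smul, Finset.smul_sum, RingHom.id_apply]

/-- `Φ^{⊗m}(X₁ ⊗ ⋯ ⊗ X_m) = Φ(X₁) ⊗ ⋯ ⊗ Φ(X_m)`. -/
theorem QChannel.tensorPow_tensorProd {a b : Type*} [Fintype a] [DecidableEq a] [Fintype b]
    (Φ : QChannel a b) (m : ℕ) (X : Fin m → Matrix a a ℂ) :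
    Φ.tensorPow m (tensorProd X) = tensorProd fun j => Φ.map (X j) := by
  have key : ∀ j (u v : b), Φ.map (X j) u v =
      ∑ z : a × a, X j z.1 z.2 * Φ.map (Matrix.single z.1 z.2 1) u v := by
    intro j u v
    conv_lhs => rw [Matrix.matrix_eq_sum_single (X j)]
    simp only [map_sum, Matrix.sum_apply, Fintype.sum_prod_type]
    refine Finset.sum_congr rfl fun x _ => Finset.sum_congr rfl fun y _ => ?_
    have : Matrix.single x y (X j x y) = X j x y • Matrix.single x y (1 : ℂ) := by
      simp [Matrix.smul_single]
    rw [this, map_smul, Matrix.smul_apply, smul_eq_mul]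
  ext u v
  simp only [QChannel.tensorPow, LinearMap.coe_mk, AddHom.coe_mk, Matrix.sum_apply,
    Matrix.smul_apply, smul_eq_mul, tensorProd, Matrix.of_apply, key, Finset.prod_univ_sum,
    Fintype.piFinset_univ, ← Finset.prod_mul_distrib]
  rw [← Fintype.sum_prod_type',
    ← (Equiv.arrowProdEquivProdArrow (Fin m) (fun _ => a) (fun _ => a)).sum_comp]
  rfl

/-- A measurement with outcomes `κ` (a POVM, or resolution of the identity) on `ℂ^d`. -/
structure Measurement (κ d : Type*) [Fintype κ] [Fintype d] [DecidableEq d] where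
  op : κ → Matrix d d ℂ
  posSemidef : ∀ w, (op w).PosSemidef
  sum_eq_one : ∑ w, op w = 1

/-- A code with `N` messages and block length `m` over the input alphabet `ι`, for a channel with
output space `ℂ^b`: each message is given a word of `m` letters, and the receiver makes a joint
measurement on the `m` outputs whose outcome is the decoded message. -/
structure QCode (ι b : Type*) [Fintype b] [DecidableEq b] (m N : ℕ) where
  word : Fin N → Fin m → ι
  decoder : Measurement (Fin N) (Fin m → b)

/-- The average error probability `N⁻¹ ∑_w (1 - Tr (σ_w M_w))` over equiprobable messages, where the
message `w ↦ (i₁, …, i_m)` is sent as `ρ_w = ρ_{i₁} ⊗ ⋯ ⊗ ρ_{i_m}` and received as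
`σ_w = Φ^{⊗m}(ρ_w)`. -/
def QCode.error {ι a b : Type*} [Fintype a] [DecidableEq a] [Fintype b] [DecidableEq b] {m N : ℕ}
    (c : QCode ι b m N) (Φ : QChannel a b) (ρ : ι → QState a) : ℝ :=
  (N : ℝ)⁻¹ * ∑ w, (1 - (Φ.tensorPow m (tensorProd fun j => (ρ (c.word w j)).matrix) *
    c.decoder.op w).trace.re)

/-- Information can be sent reliably at rate `R` with the input states `ρ`: there are codes with
`N m` messages for every block length `m`, whose rates `(log₂ (N m)) / m` tend to `R` and whose
error probabilities tend to zero. -/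
def ReliableRate {ι a b : Type*} [Fintype a] [DecidableEq a] [Fintype b] [DecidableEq b]
    (Φ : QChannel a b) (ρ : ι → QState a) (R : ℝ) : Prop :=
  ∃ (N : ℕ → ℕ) (c : ∀ m, QCode ι b m (N m)),
    Tendsto (fun m : ℕ => Real.logb 2 (N m) / m) atTop (𝓝 R) ∧
    Tendsto (fun m => (c m).error Φ ρ) atTop (𝓝 0)

/-- `S(Φ(∑ pᵢ ρᵢ)) - ∑ pᵢ S(Φ(ρᵢ))`. -/
def holevoInfo {ι a b : Type*} [Fintype ι] [Fintype a] [Fintype b] [DecidableEq b]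
    (Φ : QChannel a b) (ρ : ι → QState a) (p : stdSimplex ℝ ι) : ℝ :=
  (Φ.apply (QState.mix p ρ)).entropy - ∑ i, p i * (Φ.apply (ρ i)).entropy

/-- The coding theorem for the channel `Φ` with input states `ρ` and threshold `C`: the reliable
rates are exactly those with `R ≤ C`; below `C`, codes with exactly `⌈2^{mR}⌉` messages suffice;
above `C`, the error of all codes with at least `2^{mR}` messages is bounded away from zero. -/
def CodingThreshold {ι a b : Type*} [Fintype a] [DecidableEq a] [Fintype b] [DecidableEq b]
    (Φ : QChannel a b) (ρ : ι → QState a) (C : ℝ) : Prop :=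
  (∀ R : ℝ, 0 ≤ R → (ReliableRate Φ ρ R ↔ R ≤ C)) ∧
  (∀ R : ℝ, R < C → ∃ c : ∀ m : ℕ, QCode ι b m ⌈(2 : ℝ) ^ ((m : ℝ) * R)⌉₊,
    Tendsto (fun m => (c m).error Φ ρ) atTop (𝓝 0)) ∧
  (∀ R : ℝ, C < R → ∃ δ > 0, ∀ᶠ m : ℕ in atTop, ∀ (N : ℕ) (c : QCode ι b m N),
    (2 : ℝ) ^ ((m : ℝ) * R) ≤ N → δ ≤ c.error Φ ρ)

end

open Filter Topology
open scoped Matrix ComplexOrder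

noncomputable section

/-! Let `σ_i = Φ(ρ_i)`, `τ = ∑ p_i σ_i`, and let `χ = S(τ) - ∑ p_i S(σ_i)` be the Holevo
information.

Achievability. If the letters of a word `x` are drawn independently from `p`, the output `σ_x`
averages to `τ^{⊗m}`. By Chebyshev, up to `O(1/m)` of mass and `δ` in the exponents, `σ_x` lives on
its eigenvalues above `κ' ≈ 2^{-m ∑ p_i S(σ_i)}`, a space of dimension at most `1/κ'`, while
`τ^{⊗m}` lives on its eigenvalues below `κ ≈ 2^{-m S(τ)}`. The decoder projects onto the latter
space and then tests the codewords one after another. Gao's union bound charges message `w` for the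
initial projection, for its own test, and for false alarms of earlier codewords; each false alarm
has average probability at most `κ/κ' ≈ 2^{-mχ}`. Since only earlier codewords matter, the code can
be chosen greedily, with a bound for every message (`exists_words_and_decoder`).

Converse. The operator `M_w` is read as a test of `σ_w` against the product `τ` of the averaged
letters. Since `∑ Tr(τ M_w) = 1`, it accepts `τ` with probability `1/N` on average. The
Nussbaum–Szkoła bound replaces this quantum test by a classical one, whose error is bounded below
through the relative entropy. Relative entropy between product states is additive over positions,
and its mean at one position is the Holevo information of an ensemble of input letters, hence at
most `C` (`QCode.le_error_add`). Neither the Holevo bound nor subadditivity of entropy is used.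

Maxima. The entropy is continuous. Carathéodory's theorem bounds the ensemble size in (b), so both
maxima are taken over compact spaces.

Spectral decompositions are carried as data, so that a product state can be given the product
eigenbasis with product eigenvalues. -/

/-- The trace of a product of two positive semidefinite matrices is nonnegative. -/
theorem Matrix.PosSemidef.re_trace_mul_nonneg {d : Type*} [Fintype d] {A B : Matrix d d ℂ}
    (hA : A.PosSemidef) (hB : B.PosSemidef) : 0 ≤ (A * B).trace.re := by
  classical
  obtain ⟨C, rfl⟩ : ∃ C : Matrix d d ℂ, A = Cᴴ * C := by
    open scoped MatrixOrder Matrix.Norms.L2Operator in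
    exact CStarAlgebra.nonneg_iff_eq_star_mul_self.mp (Matrix.nonneg_iff_posSemidef.mpr hA)
  rw [Matrix.mul_assoc, Matrix.trace_mul_comm]
  exact (Complex.le_def.mp (hB.mul_mul_conjTranspose_same C).trace_nonneg).1

/-! ### Functional calculus in a chosen eigenbasis. -/

/-- A unitary diagonalization of a matrix with real eigenvalues. -/
structure Diagonalization {d : Type*} [Fintype d] [DecidableEq d] (A : Matrix d d ℂ) where
  basis : Matrix d d ℂ
  ev : d → ℝ
  conjTranspose_mul : basisᴴ * basis = 1
  mul_conjTranspose : basis * basisᴴ = 1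
  eq : A = basis * Matrix.diagonal (fun i => (ev i : ℂ)) * basisᴴ

namespace Diagonalization

variable {d : Type*} [Fintype d] [DecidableEq d] {A : Matrix d d ℂ} (D : Diagonalization A)

/-- The matrix with eigenvalues `f` in the eigenbasis of `D`. -/
def fn (f : d → ℝ) : Matrix d d ℂ :=
  D.basis * Matrix.diagonal (fun i => (f i : ℂ)) * D.basisᴴ

theorem eq_fn : A = D.fn D.ev := D.eq

theorem fn_one : D.fn (fun _ => 1) = 1 := by
  simp [fn, D.mul_conjTranspose]

theorem fn_mul (f g : d → ℝ) : D.fn f * D.fn g = D.fn fun i => f i * g i := by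
  have h : ∀ X Y : Matrix d d ℂ, D.basis * X * D.basisᴴ * (D.basis * Y * D.basisᴴ) =
      D.basis * (X * Y) * D.basisᴴ := by
    intro X Y
    calc _ = D.basis * X * (D.basisᴴ * D.basis) * Y * D.basisᴴ := by
          simp only [Matrix.mul_assoc]
      _ = _ := by rw [D.conjTranspose_mul, Matrix.mul_one]; simp only [Matrix.mul_assoc]
  simp [fn, h, Matrix.diagonal_mul_diagonal]

theorem fn_sub (f g : d → ℝ) : D.fn f - D.fn g = D.fn fun i => f i - g i := by
  simp only [fn, ← Matrix.sub_mul, ← Matrix.mul_sub, Matrix.diagonal_sub, Complex.ofReal_sub]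

theorem one_sub_fn (f : d → ℝ) : 1 - D.fn f = D.fn fun i => 1 - f i := by
  rw [← D.fn_one, fn_sub]

theorem smul_one_sub_fn (c : ℝ) (f : d → ℝ) :
    (c : ℂ) • (1 : Matrix d d ℂ) - D.fn f = D.fn fun i => c - f i := by
  have : (c : ℂ) • (1 : Matrix d d ℂ) = D.fn fun _ => c := by
    have h : (Matrix.diagonal fun _ : d => (c : ℂ)) = (c : ℂ) • 1 := by
      ext i j; simp [Matrix.diagonal_apply, Matrix.one_apply]
    rw [fn, h, Matrix.mul_smul, Matrix.mul_one, Matrix.smul_mul, D.mul_conjTranspose]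
  rw [this, fn_sub]

theorem conjTranspose_fn (f : d → ℝ) : (D.fn f)ᴴ = D.fn f := by
  have h : star (fun i => (f i : ℂ)) = fun i => (f i : ℂ) := by ext i; simp
  simp only [fn, Matrix.conjTranspose_mul, Matrix.conjTranspose_conjTranspose,
    Matrix.diagonal_conjTranspose, Matrix.mul_assoc, h]

theorem trace_fn (f : d → ℝ) : (D.fn f).trace = ((∑ i, f i : ℝ) : ℂ) := by
  rw [fn, Matrix.trace_mul_comm, ← Matrix.mul_assoc, D.conjTranspose_mul, Matrix.one_mul,
    Matrix.trace_diagonal]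
  push_cast; rfl

theorem posSemidef_fn {f : d → ℝ} (hf : ∀ i, 0 ≤ f i) : (D.fn f).PosSemidef :=
  (Matrix.posSemidef_diagonal_iff.mpr fun i => by exact_mod_cast hf i).mul_mul_conjTranspose_same _

theorem fn_indicator_mul_self (s : Set d) [DecidablePred (· ∈ s)] :
    D.fn (fun i => if i ∈ s then 1 else 0) * D.fn (fun i => if i ∈ s then 1 else 0) =
      D.fn fun i => if i ∈ s then 1 else 0 := by
  rw [fn_mul]; congr 1; ext i; split_ifs <;> simp

theorem re_trace_mul_fn (f : d → ℝ) : (A * D.fn f).trace.re = ∑ i, D.ev i * f i := by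
  have h : A * D.fn f = D.fn D.ev * D.fn f := congrArg (· * D.fn f) D.eq_fn
  rw [h, fn_mul, trace_fn, Complex.ofReal_re]

end Diagonalization

/-! ### Tensor products and their spectral decompositions. -/

section tensorProd

variable {a : Type*} {m : ℕ}

theorem tensorProd_mul [Fintype a] (X Y : Fin m → Matrix a a ℂ) :
    tensorProd X * tensorProd Y = tensorProd fun j => X j * Y j := by
  ext x y
  simp [tensorProd, Matrix.mul_apply, ← Finset.prod_mul_distrib, Finset.prod_univ_sum]

theorem tensorProd_conjTranspose (X : Fin m → Matrix a a ℂ) :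
    (tensorProd X)ᴴ = tensorProd fun j => (X j)ᴴ := by
  ext x y
  simp [tensorProd]

theorem tensorProd_diagonal [DecidableEq a] (f : Fin m → a → ℂ) :
    (tensorProd fun j => Matrix.diagonal (f j)) =
      Matrix.diagonal fun i : Fin m → a => ∏ j, f j (i j) := by
  ext x y
  by_cases h : x = y
  · subst h; simp [tensorProd]
  · obtain ⟨j, hj⟩ := Function.ne_iff.mp h
    simpa [tensorProd, Matrix.diagonal_apply_ne _ h] using
      Finset.prod_eq_zero (Finset.mem_univ j) (Matrix.diagonal_apply_ne (f j) hj)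

theorem tensorProd_one [DecidableEq a] : (tensorProd fun _ : Fin m => (1 : Matrix a a ℂ)) = 1 := by
  simpa using tensorProd_diagonal (m := m) (fun _ (_ : a) => (1 : ℂ))

/-- The tensor product of diagonalizations. -/
def Diagonalization.tensor [Fintype a] [DecidableEq a] {X : Fin m → Matrix a a ℂ}
    (D : ∀ j, Diagonalization (X j)) : Diagonalization (tensorProd X) where
  basis := tensorProd fun j => (D j).basis
  ev i := ∏ j, (D j).ev (i j)
  conjTranspose_mul := by
    rw [tensorProd_conjTranspose, tensorProd_mul]
    simp only [(D _).conjTranspose_mul, tensorProd_one]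
  mul_conjTranspose := by
    rw [tensorProd_conjTranspose, tensorProd_mul]
    simp only [(D _).mul_conjTranspose, tensorProd_one]
  eq := by
    rw [tensorProd_conjTranspose]
    simp only [Complex.ofReal_prod]
    rw [← tensorProd_diagonal fun j k => ((D j).ev k : ℂ), tensorProd_mul, tensorProd_mul]
    congr 1
    ext j : 1
    exact (D j).eq

end tensorProd

namespace QState

variable {a : Type*} [Fintype a] [DecidableEq a] (σ : QState a)

/-- The spectral decomposition of a state. -/
def diagonalization : Diagonalization σ.matrix where
  basis := σ.posSemidef.isHermitian.eigenvectorUnitary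
  ev := σ.posSemidef.isHermitian.eigenvalues
  conjTranspose_mul := by
    rw [← Matrix.star_eq_conjTranspose]; exact Unitary.coe_star_mul_self _
  mul_conjTranspose := by
    rw [← Matrix.star_eq_conjTranspose]; exact Unitary.coe_mul_star_self _
  eq := by
    conv_lhs => rw [σ.posSemidef.isHermitian.spectral_theorem]
    rfl

theorem ev_nonneg (i : a) : 0 ≤ σ.diagonalization.ev i := σ.posSemidef.eigenvalues_nonneg i

theorem sum_ev : ∑ i, σ.diagonalization.ev i = 1 := by
  have h := σ.diagonalization.trace_fn σ.diagonalization.ev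
  rw [← Diagonalization.eq_fn, σ.trace_eq_one] at h
  exact_mod_cast h.symm

theorem ev_le_one (i : a) : σ.diagonalization.ev i ≤ 1 := by
  rw [← σ.sum_ev]
  exact Finset.single_le_sum (fun i _ => σ.ev_nonneg i) (Finset.mem_univ i)

theorem entropy_eq :
    σ.entropy = -∑ i, σ.diagonalization.ev i * Real.logb 2 (σ.diagonalization.ev i) := rfl

end QState

/-! ### Sequential projections and the quantum union bound. -/

section SequentialProjections

variable {E : Type*} [NormedAddCommGroup E] [InnerProductSpace ℂ E]

/-- The product `Q_{n-1} ⋯ Q_1 Q_0`. -/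
def seqApply (Q : ℕ → E →ₗ[ℂ] E) : ℕ → E →ₗ[ℂ] E
  | 0 => LinearMap.id
  | n + 1 => Q n ∘ₗ seqApply Q n

theorem norm_sq_eq_add_of_symmetric_idempotent {Q : E →ₗ[ℂ] E} (hs : Q.IsSymmetric)
    (hi : ∀ x, Q (Q x) = Q x) (x : E) : ‖x‖ ^ 2 = ‖Q x‖ ^ 2 + ‖x - Q x‖ ^ 2 := by
  have h0 : inner ℂ (Q x) (x - Q x) = 0 := by
    rw [hs, map_sub, hi, sub_self, inner_zero_right]
  have := norm_add_sq_eq_norm_sq_add_norm_sq_of_inner_eq_zero (Q x) (x - Q x) h0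
  rw [add_sub_cancel] at this
  simpa only [sq] using this

/-- **Gao's quantum union bound**, for a vector. -/
theorem norm_sq_sub_norm_sq_seqApply_le {Q : ℕ → E →ₗ[ℂ] E} (hs : ∀ k, (Q k).IsSymmetric)
    (hi : ∀ k x, Q k (Q k x) = Q k x) (n : ℕ) (x : E) :
    ‖x‖ ^ 2 - ‖seqApply Q n x‖ ^ 2 ≤ 4 * ∑ k ∈ Finset.range n, ‖x - Q k x‖ ^ 2 := by
  set ε := ∑ k ∈ Finset.range n, ‖x - Q k x‖ ^ 2 with hε
  have hε0 : 0 ≤ ε := Finset.sum_nonneg fun _ _ => by positivity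
  have htel : ∑ k ∈ Finset.range n, ‖seqApply Q k x - Q k (seqApply Q k x)‖ ^ 2 =
      ‖x‖ ^ 2 - ‖seqApply Q n x‖ ^ 2 := by
    have : ∀ k, ‖seqApply Q k x - Q k (seqApply Q k x)‖ ^ 2 =
        ‖seqApply Q k x‖ ^ 2 - ‖seqApply Q (k + 1) x‖ ^ 2 := fun k => by
      have := norm_sq_eq_add_of_symmetric_idempotent (hs k) (hi k) (seqApply Q k x)
      simp only [seqApply, LinearMap.comp_apply]
      linarith
    simp only [this]
    exact Finset.sum_range_sub' (fun k => ‖seqApply Q k x‖ ^ 2) n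
  have hvec : x - seqApply Q n x =
      ∑ k ∈ Finset.range n, (seqApply Q k x - Q k (seqApply Q k x)) := by
    have := Finset.sum_range_sub' (fun k => seqApply Q k x) n
    simpa [seqApply] using this.symm
  -- Pair the telescoping sum `hvec` with `x`; as `1 - Q k` is a projection, it can be moved onto
  -- `x` as well.
  have hinner : ‖x‖ ^ 2 - ‖x‖ * ‖seqApply Q n x‖ ≤
      ∑ k ∈ Finset.range n, ‖x - Q k x‖ * ‖seqApply Q k x - Q k (seqApply Q k x)‖ := by
    have h1 : (inner ℂ x (x - seqApply Q n x)).re =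
        ‖x‖ ^ 2 - (inner ℂ x (seqApply Q n x)).re := by
      rw [inner_sub_right, Complex.sub_re]
      congr 1
      exact inner_self_eq_norm_sq (𝕜 := ℂ) x
    have h2 : (inner ℂ x (seqApply Q n x)).re ≤ ‖x‖ * ‖seqApply Q n x‖ :=
      re_inner_le_norm (𝕜 := ℂ) _ _
    have h3 : (inner ℂ x (x - seqApply Q n x)).re ≤
        ∑ k ∈ Finset.range n, ‖x - Q k x‖ * ‖seqApply Q k x - Q k (seqApply Q k x)‖ := by
      rw [hvec, inner_sum, Complex.re_sum]
      refine Finset.sum_le_sum fun k _ => ?_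
      set y := seqApply Q k x
      have : inner ℂ x (y - Q k y) = inner ℂ (x - Q k x) (y - Q k y) := by
        rw [inner_sub_left (x := x), hs k, map_sub, hi, sub_self, inner_zero_right, sub_zero]
      rw [this]
      exact re_inner_le_norm (𝕜 := ℂ) _ _
    linarith
  have hCS := Finset.sum_mul_sq_le_sq_mul_sq (Finset.range n) (fun k => ‖x - Q k x‖)
    (fun k => ‖seqApply Q k x - Q k (seqApply Q k x)‖)
  rw [htel, ← hε] at hCS
  have hge : 0 ≤ ‖x‖ ^ 2 - ‖seqApply Q n x‖ ^ 2 := by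
    rw [← htel]; exact Finset.sum_nonneg fun _ _ => by positivity
  set u := ‖x‖
  set v := ‖seqApply Q n x‖
  have hu : 0 ≤ u := norm_nonneg _
  have hv : 0 ≤ v := norm_nonneg _
  have hvu : v ≤ u := by nlinarith
  rcases hvu.eq_or_lt with h | h
  · rw [h]; linarith
  have hu0 : 0 < u := hv.trans_lt h
  -- Cauchy–Schwarz bounds the sum in `hinner` by `ε` times the telescoped loss `u² - v²`.
  -- Cancelling `u - v`, multiplying by `u + v` and using `u + v ≤ 2u` produces the constant 4.
  have h4 : (u * (u - v)) ^ 2 ≤ ε * (u ^ 2 - v ^ 2) := by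
    refine le_trans (pow_le_pow_left₀ (by nlinarith) ?_ 2) hCS
    linarith
  have h5 : u ^ 2 * (u - v) ≤ ε * (u + v) := by
    have : (u - v) * (u ^ 2 * (u - v)) ≤ (u - v) * (ε * (u + v)) := by linarith
    exact le_of_mul_le_mul_left this (sub_pos.mpr h)
  have h6 : u ^ 2 * (u ^ 2 - v ^ 2) ≤ u ^ 2 * (4 * ε) := by
    calc u ^ 2 * (u ^ 2 - v ^ 2) = (u ^ 2 * (u - v)) * (u + v) := by ring
      _ ≤ (ε * (u + v)) * (u + v) := by gcongr
      _ = ε * (u + v) ^ 2 := by ring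
      _ ≤ ε * (2 * u) ^ 2 := by gcongr; linarith
      _ = _ := by ring
  exact le_of_mul_le_mul_left h6 (by positivity)

end SequentialProjections

/-! ### The sequential decoder. -/

section Matrices

variable {d : Type*} [Fintype d] [DecidableEq d]

theorem toEuclideanLin_mul (X Y : Matrix d d ℂ) :
    (X * Y).toEuclideanLin = X.toEuclideanLin ∘ₗ Y.toEuclideanLin := by
  ext x : 1
  simp

/-- The product `Q_{n-1} ⋯ Q_1 Q_0` of matrices. -/
def seqProd (Q : ℕ → Matrix d d ℂ) : ℕ → Matrix d d ℂ
  | 0 => 1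
  | n + 1 => Q n * seqProd Q n

theorem toEuclideanLin_seqProd (Q : ℕ → Matrix d d ℂ) (n : ℕ) :
    (seqProd Q n).toEuclideanLin = seqApply (fun k => (Q k).toEuclideanLin) n := by
  induction n with
  | zero => ext x : 1; simp [seqProd, seqApply]
  | succ n ih => rw [seqProd, seqApply, toEuclideanLin_mul, ih]

/-- Carries inequalities for vectors over to states: they are applied to each eigenvector and
averaged with the eigenvalues. -/
theorem Diagonalization.re_trace_mul_conjTranspose_mul {A : Matrix d d ℂ} (D : Diagonalization A)
    (X : Matrix d d ℂ) : (A * (Xᴴ * X)).trace.re =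
      ∑ i, D.ev i * ‖X.toEuclideanLin (WithLp.toLp 2 (D.basis.col i))‖ ^ 2 := by
  have h : (A * (Xᴴ * X)).trace = (Matrix.diagonal (fun i => (D.ev i : ℂ)) *
      ((X * D.basis)ᴴ * (X * D.basis))).trace := by
    rw [congrArg (fun B => (B * (Xᴴ * X)).trace) D.eq, Matrix.mul_assoc, Matrix.mul_assoc,
      Matrix.trace_mul_comm, Matrix.conjTranspose_mul]
    simp only [Matrix.mul_assoc]
  rw [h, Matrix.trace, Complex.re_sum]
  refine Finset.sum_congr rfl fun i _ => ?_
  rw [Matrix.diag_apply, Matrix.diagonal_mul, Complex.re_ofReal_mul, EuclideanSpace.norm_sq_eq,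
    Matrix.mul_apply, Complex.re_sum]
  congr 1
  refine Finset.sum_congr rfl fun k _ => ?_
  rw [Matrix.conjTranspose_apply, Complex.star_def, mul_comm, Complex.mul_conj,
    Complex.ofReal_re, Complex.normSq_eq_norm_sq]
  simp [Matrix.mul_apply, Matrix.mulVec, dotProduct]

theorem isSymmetric_toEuclideanLin {P : Matrix d d ℂ} (hP : P.IsHermitian) :
    P.toEuclideanLin.IsSymmetric :=
  Matrix.isSymmetric_toEuclideanLin_iff.mpr hP

theorem toEuclideanLin_apply_apply {P : Matrix d d ℂ} (hP : P * P = P) (x : EuclideanSpace ℂ d) :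
    P.toEuclideanLin (P.toEuclideanLin x) = P.toEuclideanLin x := by
  rw [← LinearMap.comp_apply, ← toEuclideanLin_mul, hP]

theorem toEuclideanLin_one_sub (P : Matrix d d ℂ) (x : EuclideanSpace ℂ d) :
    (1 - P).toEuclideanLin x = x - P.toEuclideanLin x := by
  rw [map_sub, LinearMap.sub_apply]
  congr 1
  ext i
  simp

theorem one_sub_mul_self {P : Matrix d d ℂ} (hP : P * P = P) : (1 - P) * (1 - P) = 1 - P := by
  rw [Matrix.sub_mul, Matrix.mul_sub, Matrix.mul_sub, hP]
  simp

theorem seqProd_congr {Q Q' : ℕ → Matrix d d ℂ} {n : ℕ} (h : ∀ k < n, Q k = Q' k) :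
    seqProd Q n = seqProd Q' n := by
  induction n with
  | zero => rfl
  | succ n ih =>
    rw [seqProd, seqProd, h n n.lt_succ_self, ih fun k hk => h k (hk.trans n.lt_succ_self)]

/-- The success operator of the sequential decoder: project by `P₀`, check that the tests
`P 0, …, P (w - 1)` all fail and that the test `P w` succeeds. -/
def sequentialTest (P₀ : Matrix d d ℂ) (P : ℕ → Matrix d d ℂ) (w : ℕ) : Matrix d d ℂ :=
  P w * seqProd (fun k => 1 - P k) w * P₀

/-- The union bound for `y = P₀ x` and the projections `1 - P 0, …, 1 - P (w - 1), P w`. Replacing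
`y` by `x` in the last term gives `4 (2‖(1 - P w) x‖² + 2‖(1 - P₀) x‖²)`; with `‖x‖² - ‖y‖² = ‖(1 -
P₀) x‖²` the constants are `9 = 1 + 4·2` and `8 = 4·2`. -/
theorem norm_sq_sub_norm_sq_sequentialTest_le {P₀ : Matrix d d ℂ} {P : ℕ → Matrix d d ℂ}
    (h₀ : P₀.IsHermitian) (h₀' : P₀ * P₀ = P₀) (hP : ∀ k, (P k).IsHermitian)
    (hP' : ∀ k, P k * P k = P k) (w : ℕ) (x : EuclideanSpace ℂ d) :
    ‖x‖ ^ 2 - ‖(sequentialTest P₀ P w).toEuclideanLin x‖ ^ 2 ≤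
      9 * ‖(1 - P₀).toEuclideanLin x‖ ^ 2 + 8 * ‖(1 - P w).toEuclideanLin x‖ ^ 2 +
        4 * ∑ v ∈ Finset.range w, ‖(P v * P₀).toEuclideanLin x‖ ^ 2 := by
  set Q : ℕ → Matrix d d ℂ := fun k => if k = w then P w else 1 - P k with hQ
  have hQs : ∀ k, (Q k).toEuclideanLin.IsSymmetric := fun k => by
    refine isSymmetric_toEuclideanLin ?_
    simp only [hQ]; split_ifs
    exacts [hP w, Matrix.isHermitian_one.sub (hP k)]
  have hQi : ∀ k x, (Q k).toEuclideanLin ((Q k).toEuclideanLin x) = (Q k).toEuclideanLin x :=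
    fun k x => by
      refine toEuclideanLin_apply_apply ?_ x
      simp only [hQ]; split_ifs
      exacts [hP' w, one_sub_mul_self (hP' k)]
  have hT : sequentialTest P₀ P w = seqProd Q (w + 1) * P₀ := by
    rw [sequentialTest, seqProd]
    congr 2
    · simp [hQ]
    · exact seqProd_congr fun k hk => by simp [hQ, hk.ne]
  set y := P₀.toEuclideanLin x with hy
  have hmain := norm_sq_sub_norm_sq_seqApply_le hQs hQi (w + 1) y
  rw [← toEuclideanLin_seqProd, hy, ← LinearMap.comp_apply, ← toEuclideanLin_mul, ← hT, ← hy,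
    Finset.sum_range_succ] at hmain
  have h1 : ∀ k ∈ Finset.range w, ‖y - (Q k).toEuclideanLin y‖ ^ 2 =
      ‖(P k * P₀).toEuclideanLin x‖ ^ 2 := fun k hk => by
    rw [← toEuclideanLin_one_sub, toEuclideanLin_mul]
    simp [hQ, (Finset.mem_range.mp hk).ne, hy]
  rw [Finset.sum_congr rfl h1] at hmain
  have h2 := norm_sq_eq_add_of_symmetric_idempotent (isSymmetric_toEuclideanLin h₀)
    (toEuclideanLin_apply_apply h₀') x
  have h3 : ‖y - (Q w).toEuclideanLin y‖ ^ 2 ≤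
      2 * ‖(1 - P w).toEuclideanLin x‖ ^ 2 + 2 * ‖(1 - P₀).toEuclideanLin x‖ ^ 2 := by
    have hQw : Q w = P w := by simp [hQ]
    have e : y - (Q w).toEuclideanLin y = (1 - P w).toEuclideanLin x -
        (1 - P w).toEuclideanLin ((1 - P₀).toEuclideanLin x) := by
      rw [hQw, ← toEuclideanLin_one_sub, ← map_sub, toEuclideanLin_one_sub P₀, sub_sub_cancel]
    have hn : ‖(1 - P w).toEuclideanLin ((1 - P₀).toEuclideanLin x)‖ ^ 2 ≤
        ‖(1 - P₀).toEuclideanLin x‖ ^ 2 := by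
      have := norm_sq_eq_add_of_symmetric_idempotent (isSymmetric_toEuclideanLin (hP w))
        (toEuclideanLin_apply_apply (hP' w)) ((1 - P₀).toEuclideanLin x)
      rw [toEuclideanLin_one_sub (P w)]
      nlinarith [sq_nonneg ‖(P w).toEuclideanLin ((1 - P₀).toEuclideanLin x)‖]
    rw [e]
    have := norm_sub_le ((1 - P w).toEuclideanLin x)
      ((1 - P w).toEuclideanLin ((1 - P₀).toEuclideanLin x))
    have := pow_le_pow_left₀ (norm_nonneg _) this 2
    nlinarith [sq_nonneg (‖(1 - P w).toEuclideanLin x‖ -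
      ‖(1 - P w).toEuclideanLin ((1 - P₀).toEuclideanLin x)‖)]
  rw [← toEuclideanLin_one_sub, ← hy] at h2
  linarith

/-- Each test splits the remaining operator by `P n + (1 - P n) = 1`, so successes and the final
remainder always add up to `P₀`. -/
theorem sum_sequentialTest {P₀ : Matrix d d ℂ} {P : ℕ → Matrix d d ℂ}
    (h₀ : P₀.IsHermitian) (h₀' : P₀ * P₀ = P₀) (hP : ∀ k, (P k).IsHermitian)
    (hP' : ∀ k, P k * P k = P k) (n : ℕ) :
    ∑ w ∈ Finset.range n, (sequentialTest P₀ P w)ᴴ * sequentialTest P₀ P w +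
      (seqProd (fun k => 1 - P k) n * P₀)ᴴ * (seqProd (fun k => 1 - P k) n * P₀) = P₀ := by
  induction n with
  | zero => simp [seqProd, h₀.eq, h₀']
  | succ n ih =>
    rw [Finset.sum_range_succ, add_assoc]
    refine Eq.trans (congrArg _ ?_) ih
    have e1 : ∀ X : Matrix d d ℂ, (P n)ᴴ * (P n * X) = P n * X := fun X => by
      rw [(hP n).eq, ← Matrix.mul_assoc, hP']
    have e2 : ∀ X : Matrix d d ℂ, (1 - P n)ᴴ * ((1 - P n) * X) = (1 - P n) * X := fun X => by
      rw [(Matrix.isHermitian_one.sub (hP n)).eq, ← Matrix.mul_assoc, one_sub_mul_self (hP' n)]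
    simp only [sequentialTest, seqProd, Matrix.conjTranspose_mul, Matrix.mul_assoc, e1, e2]
    rw [← Matrix.mul_add, ← Matrix.mul_add, ← Matrix.add_mul, add_sub_cancel, Matrix.one_mul]

/-- **Sequential decoding.** Projections `P 0, …, P (N - 1)` and `P₀` give a measurement whose
`w`-th outcome operator dominates the success operator of the sequential decoder. -/
theorem exists_sequentialDecoder {P₀ : Matrix d d ℂ} {P : ℕ → Matrix d d ℂ}
    (h₀ : P₀.IsHermitian) (h₀' : P₀ * P₀ = P₀) (hP : ∀ k, (P k).IsHermitian)
    (hP' : ∀ k, P k * P k = P k) {N : ℕ} (hN : 0 < N) :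
    ∃ M : Measurement (Fin N) d, ∀ (w : Fin N) (A : Matrix d d ℂ) (_ : A.PosSemidef)
      (D : Diagonalization A), (∀ i, 0 ≤ D.ev i) →
      A.trace.re - (A * M.op w).trace.re ≤
        9 * (A * (1 - P₀)).trace.re + 8 * (A * (1 - P w)).trace.re +
          4 * ∑ v ∈ Finset.range w, (A * (P₀ * P v * P₀)).trace.re := by
  -- The inconclusive outcomes: the initial projection fails, or all tests do. They are assigned to
  -- message 0, which can only help its success; this is where `N > 0` enters.
  set R : Matrix d d ℂ := (1 - P₀) +
    (seqProd (fun k => 1 - P k) N * P₀)ᴴ * (seqProd (fun k => 1 - P k) N * P₀)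
  have hc : (1 - P₀)ᴴ * (1 - P₀) = 1 - P₀ := by
    rw [(Matrix.isHermitian_one.sub h₀).eq, one_sub_mul_self h₀']
  have hR : R.PosSemidef := by
    refine Matrix.PosSemidef.add ?_ (Matrix.posSemidef_conjTranspose_mul_self _)
    rw [← hc]
    exact Matrix.posSemidef_conjTranspose_mul_self _
  have hz : ∀ w : Fin N, (if w = ⟨0, hN⟩ then R else 0).PosSemidef := fun w => by
    split_ifs
    exacts [hR, Matrix.PosSemidef.zero]
  refine ⟨⟨fun w => (sequentialTest P₀ P w)ᴴ * sequentialTest P₀ P w +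
    if w = ⟨0, hN⟩ then R else 0, fun w => (Matrix.posSemidef_conjTranspose_mul_self _).add (hz w),
    ?_⟩, fun w A hA D hD => ?_⟩
  · rw [Finset.sum_add_distrib, Finset.sum_ite_eq' Finset.univ, if_pos (Finset.mem_univ _),
      Fin.sum_univ_eq_sum_range (fun w => (sequentialTest P₀ P w)ᴴ * sequentialTest P₀ P w)]
    have := sum_sequentialTest h₀ h₀' hP hP' N
    simp only [R]
    rw [add_left_comm, this, sub_add_cancel]
  · have h1 : (A * ((sequentialTest P₀ P w)ᴴ * sequentialTest P₀ P w)).trace.re ≤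
        (A * ((sequentialTest P₀ P w)ᴴ * sequentialTest P₀ P w +
          if w = ⟨0, hN⟩ then R else 0)).trace.re := by
      rw [Matrix.mul_add, Matrix.trace_add, Complex.add_re]
      exact le_add_of_nonneg_right (hA.re_trace_mul_nonneg (hz w))
    refine (sub_le_sub_left h1 _).trans ?_
    have hw : (1 - P w)ᴴ * (1 - P w) = 1 - P w := by
      rw [(Matrix.isHermitian_one.sub (hP w)).eq, one_sub_mul_self (hP' w)]
    have hv : ∀ v, (P v * P₀)ᴴ * (P v * P₀) = P₀ * P v * P₀ := fun v => by
      rw [Matrix.conjTranspose_mul, (hP v).eq, h₀.eq, Matrix.mul_assoc, ← Matrix.mul_assoc (P v),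
        hP', Matrix.mul_assoc]
    have ht : A.trace = (A * ((1 : Matrix d d ℂ)ᴴ * 1)).trace := by simp
    rw [ht, ← hc, ← hw]
    simp only [← hv, D.re_trace_mul_conjTranspose_mul, Finset.mul_sum (s := Finset.univ)]
    rw [Finset.sum_comm, Finset.mul_sum, ← Finset.sum_sub_distrib, ← Finset.sum_add_distrib,
      ← Finset.sum_add_distrib]
    refine Finset.sum_le_sum fun i _ => ?_
    have := mul_le_mul_of_nonneg_left (norm_sq_sub_norm_sq_sequentialTest_le h₀ h₀' hP hP' w
      (WithLp.toLp 2 (D.basis.col i))) (hD i)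
    have h1 : (1 : Matrix d d ℂ).toEuclideanLin (WithLp.toLp 2 (D.basis.col i)) =
        WithLp.toLp 2 (D.basis.col i) := by ext j; simp
    rw [h1, ← Finset.mul_sum]
    linarith

end Matrices

/-! ### Independent letters, Chebyshev's inequality, greedy selection. -/

section ProductWeights

variable {α : Type*} [Fintype α]

theorem sum_prod_weights {m : ℕ} (w : Fin m → α → ℝ) (hw : ∀ j, ∑ a, w j a = 1) :
    ∑ x : Fin m → α, ∏ j, w j (x j) = 1 := by
  classical
  rw [← Fintype.piFinset_univ, ← Finset.prod_univ_sum]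
  simp [hw]

theorem sum_fin_succ_arrow {m : ℕ} (F : (Fin (m + 1) → α) → ℝ) :
    ∑ x, F x = ∑ a, ∑ y : Fin m → α, F (Fin.cons a y) := by
  rw [← Fintype.sum_prod_type', ← (Fin.consEquiv fun _ : Fin (m + 1) => α).sum_comp]
  rfl

/-- The expectation of a sum of functions of independent variables. -/
theorem sum_prod_weights_mul_sum {m : ℕ} (w g : Fin m → α → ℝ) (hw : ∀ j, ∑ a, w j a = 1) :
    ∑ x : Fin m → α, (∏ j, w j (x j)) * ∑ j, g j (x j) = ∑ j, ∑ a, w j a * g j a := by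
  induction m with
  | zero => simp
  | succ m ih =>
    rw [sum_fin_succ_arrow]
    simp only [Fin.prod_univ_succ, Fin.sum_univ_succ, Fin.cons_zero, Fin.cons_succ]
    have h1 := ih (fun j => w j.succ) (fun j => g j.succ) fun j => hw _
    have h2 := sum_prod_weights (fun j : Fin m => w j.succ) fun j => hw _
    have : ∀ a, ∑ y : Fin m → α, w 0 a * (∏ j, w j.succ (y j)) * (g 0 a + ∑ j, g j.succ (y j)) =
        w 0 a * g 0 a + w 0 a * ∑ j : Fin m, ∑ a, w j.succ a * g j.succ a := by
      intro a
      simp only [mul_add, Finset.sum_add_distrib, mul_assoc, ← Finset.mul_sum, h1]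
      rw [← Finset.sum_mul, h2, one_mul]
    simp only [this, Finset.sum_add_distrib, ← Finset.sum_mul, hw, one_mul]

/-- Variances of independent centred variables add: the cross terms vanish because the sum over the
remaining letters has mean zero. -/
theorem sum_prod_weights_mul_sum_sq {w g : α → ℝ} (hw : ∑ a, w a = 1)
    (hg : ∑ a, w a * g a = 0) (m : ℕ) :
    ∑ x : Fin m → α, (∏ j, w (x j)) * (∑ j, g (x j)) ^ 2 = m * ∑ a, w a * g a ^ 2 := by
  induction m with
  | zero => simp
  | succ m ih =>
    rw [sum_fin_succ_arrow]
    simp only [Fin.prod_univ_succ, Fin.sum_univ_succ, Fin.cons_zero, Fin.cons_succ]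
    have : ∀ a, ∑ y : Fin m → α, w a * (∏ j, w (y j)) * (g a + ∑ j, g (y j)) ^ 2 =
        w a * g a ^ 2 + w a * (m * ∑ a, w a * g a ^ 2) := by
      intro a
      have e : ∀ y : Fin m → α, w a * (∏ j, w (y j)) * (g a + ∑ j, g (y j)) ^ 2 =
          w a * g a ^ 2 * (∏ j, w (y j)) + 2 * w a * g a * ((∏ j, w (y j)) * ∑ j, g (y j)) +
            w a * ((∏ j, w (y j)) * (∑ j, g (y j)) ^ 2) := fun y => by ring
      have h0 := sum_prod_weights_mul_sum (m := m) (fun _ => w) (fun _ => g) fun _ => hw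
      simp only [hg, Finset.sum_const_zero] at h0
      simp only [e, Finset.sum_add_distrib, ← Finset.mul_sum, ih, h0,
        sum_prod_weights (fun _ => w) fun _ => hw]
      ring
    simp only [this, Finset.sum_add_distrib, ← Finset.sum_mul, hw]
    push_cast
    ring

/-- **Chebyshev's inequality** for sums of independent centred variables. -/
theorem sum_prod_weights_tail_le {w g : α → ℝ} (hw₀ : ∀ a, 0 ≤ w a) (hw : ∑ a, w a = 1)
    (hg : ∑ a, w a * g a = 0) {m : ℕ} (hm : 0 < m) {δ : ℝ} (hδ : 0 < δ) :
    ∑ x : Fin m → α, (if m * δ ≤ ∑ j, g (x j) then ∏ j, w (x j) else 0) ≤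
      (∑ a, w a * g a ^ 2) / (m * δ ^ 2) := by
  have hm' : (0 : ℝ) < m := by exact_mod_cast hm
  -- The extra factor `m` turns the right side into the second moment and `m δ²` into `(m δ)²`.
  rw [le_div_iff₀ (by positivity), ← mul_le_mul_iff_right₀ hm', ← sum_prod_weights_mul_sum_sq hw hg,
    Finset.sum_mul, Finset.mul_sum]
  refine Finset.sum_le_sum fun x _ => ?_
  have hp : 0 ≤ ∏ j, w (x j) := Finset.prod_nonneg fun j _ => hw₀ _
  split_ifs with h
  · have := pow_le_pow_left₀ (by positivity) h 2
    nlinarith [mul_le_mul_of_nonneg_left this hp]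
  · rw [zero_mul, mul_zero]; positivity

/-- A greedy choice of codewords: a point that is good on average can be added to any
finite sequence. -/
theorem exists_greedy_sequence {p h : α → ℝ} {f : α → α → ℝ} {H β : ℝ} (hp₀ : ∀ a, 0 ≤ p a)
    (hp : ∑ a, p a = 1) (hh : ∑ a, p a * h a ≤ H) (hf : ∀ v, ∑ a, p a * f v a ≤ β) (N : ℕ) :
    ∃ x : ℕ → α, ∀ w < N, h (x w) + ∑ v ∈ Finset.range w, f (x v) (x w) ≤ H + w * β := by
  classical
  -- The inequality holds on average over `a`, whatever the earlier points are, so it holds for some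
  -- `a`.
  have key : ∀ (n : ℕ) (x : ℕ → α), ∃ a, h a + ∑ v ∈ Finset.range n, f (x v) a ≤ H + n * β := by
    intro n x
    by_contra! hcon
    have hpos : ∃ a, 0 < p a := by
      by_contra! h0
      have : ∑ a, p a ≤ 0 := Finset.sum_nonpos fun a _ => h0 a
      linarith
    obtain ⟨a₀, ha₀⟩ := hpos
    have h1 : ∑ a, p a * (H + n * β) <
        ∑ a, p a * (h a + ∑ v ∈ Finset.range n, f (x v) a) :=
      Finset.sum_lt_sum (fun a _ => mul_le_mul_of_nonneg_left (hcon a).le (hp₀ a))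
        ⟨a₀, Finset.mem_univ _, mul_lt_mul_of_pos_left (hcon a₀) ha₀⟩
    rw [← Finset.sum_mul, hp, one_mul] at h1
    simp only [mul_add, Finset.sum_add_distrib, Finset.mul_sum] at h1
    rw [Finset.sum_comm] at h1
    have h2 : ∑ v ∈ Finset.range n, ∑ a, p a * f (x v) a ≤ n * β := by
      refine (Finset.sum_le_sum fun v _ => hf (x v)).trans ?_
      simp
    linarith
  induction N with
  | zero =>
    obtain ⟨a, -⟩ := key 0 fun _ => (Finset.univ_nonempty_iff.mp (by
      by_contra h0
      rw [Finset.not_nonempty_iff_eq_empty] at h0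
      simp [h0] at hp)).some
    exact ⟨fun _ => a, by simp⟩
  | succ N ih =>
    obtain ⟨x, hx⟩ := ih
    obtain ⟨a, ha⟩ := key N x
    refine ⟨Function.update x N a, fun w hw => ?_⟩
    have hs : ∑ v ∈ Finset.range w, f (Function.update x N a v) (Function.update x N a w) =
        ∑ v ∈ Finset.range w, f (x v) (Function.update x N a w) := by
      refine Finset.sum_congr rfl fun v hv => ?_
      have := Finset.mem_range.mp hv
      rw [Function.update_of_ne (show v ≠ N by omega)]
    rw [hs]
    rcases (Nat.lt_succ_iff.mp hw).eq_or_lt with rfl | hlt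
    · simpa using ha
    · rw [Function.update_of_ne hlt.ne]
      exact hx w hlt

end ProductWeights

/-! ### Typical eigenvalues of product states. -/

section TensorStates

theorem sum_smul_tensorProd {ι b : Type*} [Fintype ι] {m : ℕ} (p : ι → ℝ) (X : ι → Matrix b b ℂ) :
    ∑ x : Fin m → ι, ((∏ j, p (x j) : ℝ) : ℂ) • tensorProd (fun j => X (x j)) =
      tensorProd fun _ => ∑ i, (p i : ℂ) • X i := by
  classical
  ext u v
  simp [tensorProd, Matrix.sum_apply, ← Finset.prod_mul_distrib, Finset.prod_univ_sum]

variable {b : Type*} [Fintype b] [DecidableEq b] {m : ℕ}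

/-- The product spectral decomposition of a product state. -/
def tensorDiag (σ : Fin m → QState b) : Diagonalization (tensorProd fun j => (σ j).matrix) :=
  Diagonalization.tensor fun j => (σ j).diagonalization

theorem tensorDiag_ev (σ : Fin m → QState b) (i : Fin m → b) :
    (tensorDiag σ).ev i = ∏ j, (σ j).diagonalization.ev (i j) := rfl

theorem tensorDiag_ev_nonneg (σ : Fin m → QState b) (i : Fin m → b) :
    0 ≤ (tensorDiag σ).ev i := by
  rw [tensorDiag_ev]
  exact Finset.prod_nonneg fun j _ => (σ j).ev_nonneg _

theorem sum_tensorDiag_ev (σ : Fin m → QState b) : ∑ i, (tensorDiag σ).ev i = 1 :=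
  sum_prod_weights (fun j => (σ j).diagonalization.ev) fun j => (σ j).sum_ev

theorem posSemidef_tensorProd (σ : Fin m → QState b) :
    (tensorProd fun j => (σ j).matrix).PosSemidef := by
  rw [(tensorDiag σ).eq_fn]
  exact (tensorDiag σ).posSemidef_fn (tensorDiag_ev_nonneg σ)

theorem trace_tensorProd (σ : Fin m → QState b) : (tensorProd fun j => (σ j).matrix).trace = 1 := by
  rw [(tensorDiag σ).eq_fn, Diagonalization.trace_fn, sum_tensorDiag_ev, Complex.ofReal_one]

theorem log_prod_of_ne_zero {r : Fin m → ℝ} (h : ∏ j, r j ≠ 0) :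
    Real.logb 2 (∏ j, r j) = ∑ j, Real.logb 2 (r j) :=
  Real.logb_prod _ _ fun j _ => Finset.prod_ne_zero_iff.mp h j (Finset.mem_univ j)

/-- The eigenvalues of `σ^{⊗m}` above `2^{-m(S(σ)-δ)}` have small total weight. -/
theorem sum_large_ev_le (σ : QState b) (hm : 0 < m) {δ : ℝ} (hδ : 0 < δ) :
    ∑ i, (if (2 : ℝ) ^ (-(m * (σ.entropy - δ))) < (tensorDiag fun _ : Fin m => σ).ev i then
      (tensorDiag fun _ : Fin m => σ).ev i else 0) ≤
    (∑ k, σ.diagonalization.ev k * (Real.logb 2 (σ.diagonalization.ev k) + σ.entropy) ^ 2) /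
      (m * δ ^ 2) := by
  refine le_trans (Finset.sum_le_sum fun i _ => ?_) (sum_prod_weights_tail_le σ.ev_nonneg σ.sum_ev
    (g := fun k => Real.logb 2 (σ.diagonalization.ev k) + σ.entropy) ?_ hm hδ)
  · have h0 := tensorDiag_ev_nonneg (fun _ : Fin m => σ) i
    split_ifs with h1 h2 h2
    · rfl
    · exfalso
      have hpos := (Real.rpow_pos_of_pos two_pos _).trans h1
      have := (Real.lt_logb_iff_rpow_lt one_lt_two hpos).mpr h1
      rw [tensorDiag_ev] at hpos this
      rw [log_prod_of_ne_zero hpos.ne'] at this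
      simp only [Finset.sum_add_distrib, Finset.sum_const, Finset.card_univ, Fintype.card_fin,
        nsmul_eq_mul] at h2
      linarith
    · exact h0
    · rfl
  · simp only [mul_add, Finset.sum_add_distrib, ← Finset.sum_mul, σ.sum_ev, σ.entropy_eq]
    ring

/-- The eigenvalues of `σ_{x₁} ⊗ ⋯ ⊗ σ_{x_m}` below `2^{-m(∑ pᵢ S(σᵢ)+δ)}` have small total weight
on average over words `x` with independent letters. -/
theorem sum_small_ev_le {ι : Type*} [Fintype ι] {p : ι → ℝ} (hp₀ : ∀ i, 0 ≤ p i)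
    (hp : ∑ i, p i = 1) (σ : ι → QState b) (hm : 0 < m) {δ : ℝ} (hδ : 0 < δ) :
    ∑ x : Fin m → ι, (∏ j, p (x j)) * ∑ i, (if (tensorDiag fun j => σ (x j)).ev i <
      (2 : ℝ) ^ (-(m * (∑ i, p i * (σ i).entropy + δ))) then
        (tensorDiag fun j => σ (x j)).ev i else 0) ≤
    (∑ z : ι × b, p z.1 * (σ z.1).diagonalization.ev z.2 *
      (-Real.logb 2 ((σ z.1).diagonalization.ev z.2) - ∑ i, p i * (σ i).entropy) ^ 2) /
      (m * δ ^ 2) := by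
  set s := ∑ i, p i * (σ i).entropy with hs
  -- A word together with an eigenvalue index is a word of independent pairs `(i, k)` with weights
  -- `p_i λ_k(σ_i)`; under them `-log λ` has mean `s`.
  refine le_trans ?_ (sum_prod_weights_tail_le (α := ι × b)
    (w := fun z => p z.1 * (σ z.1).diagonalization.ev z.2)
    (g := fun z => -Real.logb 2 ((σ z.1).diagonalization.ev z.2) - s) ?_ ?_ ?_ hm hδ)
  · rw [← (Equiv.arrowProdEquivProdArrow (Fin m) (fun _ => ι) (fun _ => b)).symm.sum_comp,
      Fintype.sum_prod_type]
    simp only [Finset.mul_sum]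
    refine Finset.sum_le_sum fun x _ => Finset.sum_le_sum fun i _ => ?_
    have e : ∀ j, (Equiv.arrowProdEquivProdArrow (Fin m) (fun _ => ι) (fun _ => b)).symm (x, i) j =
      (x j, i j) := fun j => rfl
    have hP : 0 ≤ ∏ j, p (x j) := Finset.prod_nonneg fun j _ => hp₀ _
    have h0 := tensorDiag_ev_nonneg (fun j => σ (x j)) i
    simp only [e, Finset.prod_mul_distrib]
    split_ifs with h1 h2 h2
    · rfl
    -- A zero eigenvalue, whose `logb` is the default value 0, carries no weight.
    · rcases h0.eq_or_lt with h0 | hpos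
      · rw [← h0, mul_zero]
      exfalso
      replace h2 : ¬ (m : ℝ) * δ ≤
        ∑ j, (-Real.logb 2 ((σ (x j)).diagonalization.ev (i j)) - s) := h2
      have := (Real.logb_lt_iff_lt_rpow one_lt_two hpos).mpr h1
      rw [tensorDiag_ev] at hpos this
      rw [log_prod_of_ne_zero hpos.ne'] at this
      simp only [Finset.sum_sub_distrib, Finset.sum_neg_distrib, Finset.sum_const,
        Finset.card_univ, Fintype.card_fin, nsmul_eq_mul] at h2
      linarith
    · rw [mul_zero]; positivity
    · rw [mul_zero]
  · exact fun z => mul_nonneg (hp₀ _) ((σ z.1).ev_nonneg _)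
  · rw [Fintype.sum_prod_type]
    simp only [← Finset.mul_sum, (σ _).sum_ev, mul_one, hp]
  · rw [Fintype.sum_prod_type]
    have : ∀ i, ∑ k, p i * (σ i).diagonalization.ev k *
        (-Real.logb 2 ((σ i).diagonalization.ev k) - s) = p i * (σ i).entropy - p i * s := by
      intro i
      simp only [mul_assoc, ← Finset.mul_sum, mul_sub, Finset.sum_sub_distrib, ← Finset.sum_mul,
        (σ i).sum_ev, mul_neg, Finset.sum_neg_distrib, (σ i).entropy_eq, one_mul]
    simp only [this, Finset.sum_sub_distrib, ← Finset.sum_mul, hp, ← hs]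
    ring

end TensorStates

/-! ### Achievability at a fixed block length. -/

section OneShot

variable {b : Type*} [Fintype b] [DecidableEq b]

/-- `P₀ A P₀ ≤ κ` when `P₀` is the spectral projection of `A` onto the eigenvalues at most `κ`. -/
theorem re_trace_mul_sandwich_le {d : Type*} [Fintype d] [DecidableEq d] {A P : Matrix d d ℂ}
    (D : Diagonalization A) (hP : P.PosSemidef) {κ : ℝ} (hκ : 0 ≤ κ) :
    (A * (D.fn (fun i => if D.ev i ≤ κ then 1 else 0) * P *
      D.fn (fun i => if D.ev i ≤ κ then 1 else 0))).trace.re ≤ κ * P.trace.re := by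
  set T := D.fn fun i => if D.ev i ≤ κ then 1 else 0 with hT
  have h1 : T * A * T = D.fn fun i => if D.ev i ≤ κ then D.ev i else 0 := by
    have : T * A * T = T * D.fn D.ev * T := congrArg (fun X => T * X * T) D.eq_fn
    rw [this, hT, D.fn_mul, D.fn_mul]
    congr 1
    ext i
    split_ifs <;> simp
  have h2 : (A * (T * P * T)).trace = (P * (T * A * T)).trace := by
    calc (A * (T * P * T)).trace = ((A * T) * (P * T)).trace := by simp only [Matrix.mul_assoc]
      _ = ((P * T) * (A * T)).trace := Matrix.trace_mul_comm _ _
      _ = _ := by simp only [Matrix.mul_assoc]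
  have h3 : 0 ≤ (P * ((κ : ℂ) • (1 : Matrix d d ℂ) - T * A * T)).trace.re := by
    refine hP.re_trace_mul_nonneg ?_
    rw [h1, D.smul_one_sub_fn]
    refine D.posSemidef_fn fun i => ?_
    split_ifs with h
    · linarith
    · linarith
  rw [Matrix.mul_sub, Matrix.trace_sub, Matrix.mul_smul, Matrix.mul_one, Matrix.trace_smul,
    smul_eq_mul, Complex.sub_re, Complex.re_ofReal_mul] at h3
  rw [h2]
  linarith

/-- The one-shot form of the direct coding theorem. -/
theorem exists_words_and_decoder {ι : Type*} [Fintype ι] {p : ι → ℝ} (hp₀ : ∀ i, 0 ≤ p i)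
    (hp : ∑ i, p i = 1) (σ : ι → QState b) (τ : QState b)
    (hτ : τ.matrix = ∑ i, (p i : ℂ) • (σ i).matrix) {δ : ℝ} (hδ : 0 < δ) :
    ∃ V : ℝ, ∀ m N : ℕ, 0 < m → 0 < N →
      ∃ (x : Fin N → Fin m → ι) (M : Measurement (Fin N) (Fin m → b)), ∀ w,
        1 - (tensorProd (fun j => (σ (x w j)).matrix) * M.op w).trace.re ≤
          V / m + 4 * (w * (2 : ℝ) ^ (-(m * (τ.entropy - ∑ i, p i * (σ i).entropy - 2 * δ)))) := by
  set s := ∑ i, p i * (σ i).entropy with hs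
  set V₀ := ∑ k, τ.diagonalization.ev k *
    (Real.logb 2 (τ.diagonalization.ev k) + τ.entropy) ^ 2
  set V₁ := ∑ z : ι × b, p z.1 * (σ z.1).diagonalization.ev z.2 *
      (-Real.logb 2 ((σ z.1).diagonalization.ev z.2) - s) ^ 2
  refine ⟨9 * (V₀ / δ ^ 2) + 8 * (V₁ / δ ^ 2), fun m N hm hN => ?_⟩
  set κ : ℝ := 2 ^ (-(m * (τ.entropy - δ)))
  set κ' : ℝ := 2 ^ (-(m * (s + δ)))
  have hκ : 0 < κ := Real.rpow_pos_of_pos two_pos _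
  have hκ' : 0 < κ' := Real.rpow_pos_of_pos two_pos _
  set D₀ := tensorDiag fun _ : Fin m => τ
  set P₀ := D₀.fn fun i => if D₀.ev i ≤ κ then 1 else 0
  set D : ∀ x : Fin m → ι, Diagonalization (tensorProd fun j => (σ (x j)).matrix) :=
    fun x => tensorDiag fun j => σ (x j)
  set P : (Fin m → ι) → Matrix (Fin m → b) (Fin m → b) ℂ :=
    fun x => (D x).fn fun i => if κ' ≤ (D x).ev i then 1 else 0
  set pm : (Fin m → ι) → ℝ := fun x => ∏ j, p (x j)
  have hpm₀ : ∀ x, 0 ≤ pm x := fun x => Finset.prod_nonneg fun j _ => hp₀ _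
  have hpm : ∑ x, pm x = 1 := sum_prod_weights (fun _ => p) fun _ => hp
  have hP₀ : P₀.IsHermitian := D₀.conjTranspose_fn _
  have hP₀' : P₀ * P₀ = P₀ := D₀.fn_indicator_mul_self {i | D₀.ev i ≤ κ}
  have hP : ∀ x, (P x).IsHermitian := fun x => (D x).conjTranspose_fn _
  have hP' : ∀ x, P x * P x = P x := fun x => (D x).fn_indicator_mul_self {i | κ' ≤ (D x).ev i}
  have hPpos : ∀ x, (P x).PosSemidef := fun x => (D x).posSemidef_fn fun i => by
    split_ifs <;> norm_num
  -- Each eigenvalue kept by `P x` is at least `κ'` and all of them sum to 1, which bounds their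
  -- number.
  have htrP : ∀ x, (P x).trace.re ≤ κ'⁻¹ := by
    intro x
    rw [Diagonalization.trace_fn, Complex.ofReal_re, ← one_div, le_div_iff₀ hκ', Finset.sum_mul]
    refine (Finset.sum_le_sum fun i _ => ?_).trans_eq (sum_tensorDiag_ev fun j => σ (x j))
    have h0 : 0 ≤ (D x).ev i := tensorDiag_ev_nonneg _ i
    split_ifs with h
    · rw [one_mul]; exact h
    · rw [zero_mul]; exact h0
  have havg : ∀ X : Matrix (Fin m → b) (Fin m → b) ℂ,
      ∑ x, pm x * (tensorProd (fun j => (σ (x j)).matrix) * X).trace.re =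
        ((tensorProd fun _ : Fin m => τ.matrix) * X).trace.re := by
    intro X
    rw [hτ, ← sum_smul_tensorProd, Finset.sum_mul, Matrix.trace_sum, Complex.re_sum]
    refine Finset.sum_congr rfl fun x _ => ?_
    rw [Matrix.smul_mul, Matrix.trace_smul, smul_eq_mul, Complex.re_ofReal_mul]
  have hH : ∑ x, pm x * (9 * (tensorProd (fun j => (σ (x j)).matrix) * (1 - P₀)).trace.re +
      8 * (tensorProd (fun j => (σ (x j)).matrix) * (1 - P x)).trace.re) ≤
      9 * (V₀ / (m * δ ^ 2)) + 8 * (V₁ / (m * δ ^ 2)) := by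
    simp only [mul_add, Finset.sum_add_distrib, mul_left_comm (pm _), ← Finset.mul_sum]
    refine add_le_add (mul_le_mul_of_nonneg_left ?_ (by norm_num))
      (mul_le_mul_of_nonneg_left ?_ (by norm_num))
    · rw [havg, D₀.one_sub_fn, D₀.re_trace_mul_fn]
      refine le_trans (Finset.sum_le_sum fun i _ => ?_) (sum_large_ev_le τ hm hδ)
      by_cases h : D₀.ev i ≤ κ
      · simp [h, D₀, κ, not_lt.mpr h]
      · simp only [h, if_false, sub_zero, mul_one]
        rw [if_pos (not_le.mp h)]
    · refine le_trans (Finset.sum_le_sum fun x _ => mul_le_mul_of_nonneg_left ?_ (hpm₀ x))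
        (sum_small_ev_le hp₀ hp σ hm hδ)
      rw [(D x).one_sub_fn, (D x).re_trace_mul_fn]
      refine Finset.sum_le_sum fun i _ => ?_
      by_cases h : κ' ≤ (D x).ev i
      · simp only [h, if_true, sub_self, mul_zero]
        rw [if_neg (not_lt.mpr h)]
      · simp only [h, if_false, sub_zero, mul_one]
        rw [if_pos (not_le.mp h)]
  -- The false alarm of a fixed earlier codeword `v`, averaged over the new one: the average state
  -- is `τ^{⊗m}`, and `P₀` cuts it down to at most `κ`.
  have hF : ∀ v, ∑ x, pm x * (4 * (tensorProd (fun j => (σ (x j)).matrix) *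
      (P₀ * P v * P₀)).trace.re) ≤ 4 * (κ * κ'⁻¹) := by
    intro v
    simp only [mul_left_comm (pm _), ← Finset.mul_sum, havg]
    refine mul_le_mul_of_nonneg_left ?_ (by norm_num)
    exact (re_trace_mul_sandwich_le D₀ (hPpos v) hκ.le).trans
      (mul_le_mul_of_nonneg_left (htrP v) hκ.le)
  obtain ⟨x, hx⟩ := exists_greedy_sequence hpm₀ hpm hH hF N
  obtain ⟨M, hM⟩ := exists_sequentialDecoder hP₀ hP₀' (fun k => hP (x k)) (fun k => hP' (x k)) hN
  refine ⟨fun w => x w, M, fun w => ?_⟩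
  have h1 := hM w _ (posSemidef_tensorProd fun j => σ (x w j)) (D (x w))
    (tensorDiag_ev_nonneg fun j => σ (x w j))
  rw [trace_tensorProd, Complex.one_re, Finset.mul_sum] at h1
  refine (h1.trans (hx w w.2)).trans (le_of_eq ?_)
  have hκκ : κ * κ'⁻¹ = 2 ^ (-(m * (τ.entropy - s - 2 * δ))) := by
    rw [← Real.rpow_neg two_pos.le, ← Real.rpow_add two_pos]
    congr 1
    ring
  rw [hκκ]
  have hm' : (m : ℝ) ≠ 0 := by positivity
  field_simp

end OneShot

/-! ### Codes, their errors, and the direct theorem. -/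

section Codes

theorem QChannel.apply_mix_matrix {a b κ : Type*} [Fintype a] [Fintype b] [Fintype κ]
    (Φ : QChannel a b) (p : stdSimplex ℝ κ) (ρ : κ → QState a) : (Φ.apply (QState.mix p ρ)).matrix =
      ∑ i, (p i : ℂ) • (Φ.apply (ρ i)).matrix := by
  simp [QChannel.apply, QState.mix]

variable {ι a b : Type*} [Fintype a] [DecidableEq a] [Fintype b] [DecidableEq b]

theorem QCode.error_eq {m N : ℕ} (c : QCode ι b m N) (Φ : QChannel a b) (ρ : ι → QState a) :
    c.error Φ ρ = (N : ℝ)⁻¹ * ∑ w, (1 - (tensorProd (fun j => (Φ.apply (ρ (c.word w j))).matrix) *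
      c.decoder.op w).trace.re) := by
  simp only [QCode.error, QChannel.tensorPow_tensorProd]
  rfl

theorem Measurement.re_trace_mul_le {κ d : Type*} [Fintype κ] [Fintype d] [DecidableEq d]
    (M : Measurement κ d) {A : Matrix d d ℂ} (hA : A.PosSemidef) (w : κ) :
    (A * M.op w).trace.re ≤ A.trace.re := by
  have h : A.trace.re = ∑ v, (A * M.op v).trace.re := by
    rw [← Complex.re_sum, ← Matrix.trace_sum, ← Finset.mul_sum, M.sum_eq_one, Matrix.mul_one]
  rw [h]
  exact Finset.single_le_sum (fun v _ => hA.re_trace_mul_nonneg (M.posSemidef v))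
    (Finset.mem_univ w)

theorem QCode.error_nonneg {m N : ℕ} (c : QCode ι b m N) (Φ : QChannel a b) (ρ : ι → QState a) :
    0 ≤ c.error Φ ρ := by
  rw [QCode.error_eq]
  refine mul_nonneg (by positivity) (Finset.sum_nonneg fun w _ => ?_)
  have h := c.decoder.re_trace_mul_le (posSemidef_tensorProd fun j => Φ.apply (ρ (c.word w j))) w
  rw [trace_tensorProd, Complex.one_re] at h
  linarith

theorem QCode.error_le {m N : ℕ} (c : QCode ι b m N) (Φ : QChannel a b) (ρ : ι → QState a)
    (hN : 0 < N) {B : ℝ} (h : ∀ w, 1 - (tensorProd (fun j => (Φ.apply (ρ (c.word w j))).matrix) *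
      c.decoder.op w).trace.re ≤ B) : c.error Φ ρ ≤ B := by
  have hN' : (0 : ℝ) < N := by exact_mod_cast hN
  rw [QCode.error_eq, inv_mul_le_iff₀ hN']
  refine (Finset.sum_le_sum fun w _ => h w).trans ?_
  simp

/-- **Direct coding theorem.** -/
theorem eventually_exists_code [Fintype ι] (Φ : QChannel a b) (ρ : ι → QState a)
    (p : stdSimplex ℝ ι) {R : ℝ} (hR : R < holevoInfo Φ ρ p) {ε : ℝ} (hε : 0 < ε) :
    ∀ᶠ m : ℕ in atTop, ∃ c : QCode ι b m ⌈(2 : ℝ) ^ ((m : ℝ) * R)⌉₊, c.error Φ ρ < ε := by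
  set η := holevoInfo Φ ρ p - R with hη
  have hη0 : 0 < η := sub_pos.mpr hR
  have hτ := Φ.apply_mix_matrix p ρ
  -- With `δ = η/4` the exponent loses `2δ = η/2` of the gap `η`, so the false alarms sum to at most
  -- `4 · 2^{-mη/2}`.
  obtain ⟨V, hV⟩ := exists_words_and_decoder (p := p) p.2.1 p.2.2 (fun i => Φ.apply (ρ i)) _ hτ
    (show 0 < η / 4 by positivity)
  have hlim : Tendsto (fun m : ℕ => V / m + 4 * ((2 : ℝ) ^ (-(η / 2))) ^ m) atTop (𝓝 0) := by
    have h1 : Tendsto (fun m : ℕ => V / m) atTop (𝓝 0) := tendsto_const_div_atTop_nhds_zero_nat V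
    have h2 := (tendsto_pow_atTop_nhds_zero_of_lt_one (r := (2 : ℝ) ^ (-(η / 2)))
      (by positivity) (Real.rpow_lt_one_of_one_lt_of_neg one_lt_two (by linarith))).const_mul 4
    simpa using h1.add h2
  filter_upwards [hlim.eventually_lt_const hε, eventually_gt_atTop 0] with m hm hm0
  have hN : 0 < ⌈(2 : ℝ) ^ ((m : ℝ) * R)⌉₊ := Nat.ceil_pos.mpr (by positivity)
  obtain ⟨x, M, hx⟩ := hV m _ hm0 hN
  refine ⟨⟨x, M⟩, lt_of_le_of_lt (QCode.error_le _ Φ ρ hN fun w => (hx w).trans ?_) hm⟩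
  -- Messages are numbered from 0, so `w` is the number of earlier codewords and stays below
  -- `2^{mR}` in spite of the ceiling.
  have hw : (w : ℝ) ≤ 2 ^ ((m : ℝ) * R) := (Nat.lt_ceil.mp w.2).le
  gcongr
  calc (w : ℝ) * _ ≤ 2 ^ ((m : ℝ) * R) * _ := by gcongr
    _ = ((2 : ℝ) ^ (-(η / 2))) ^ m := by
      rw [← Real.rpow_natCast, ← Real.rpow_mul two_pos.le, ← Real.rpow_add two_pos]
      congr 1
      simp only [hη, holevoInfo]
      ring

end Codes

/-! ### Binary tests, eigenbasis overlaps and relative entropy. -/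

theorem Matrix.re_mul_conjTranspose_apply {d : Type*} [Fintype d] (X : Matrix d d ℂ) (i : d) :
    ((X * Xᴴ) i i).re = ∑ j, ‖X i j‖ ^ 2 := by
  rw [Matrix.mul_apply, Complex.re_sum]
  refine Finset.sum_congr rfl fun k _ => ?_
  rw [Matrix.conjTranspose_apply, Complex.star_def, Complex.mul_conj,
    Complex.ofReal_re, Complex.normSq_eq_norm_sq]

namespace Diagonalization

variable {d : Type*} [Fintype d] [DecidableEq d] {A B : Matrix d d ℂ}

/-- The squared overlaps of two eigenbases. -/
def overlap (D : Diagonalization A) (E : Diagonalization B) (i j : d) : ℝ :=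
  ‖(D.basisᴴ * E.basis) i j‖ ^ 2

theorem overlap_nonneg (D : Diagonalization A) (E : Diagonalization B) (i j : d) :
    0 ≤ D.overlap E i j := by
  unfold overlap; positivity

theorem overlap_comm (D : Diagonalization A) (E : Diagonalization B) (i j : d) :
    E.overlap D j i = D.overlap E i j := by
  have : E.basisᴴ * D.basis = (D.basisᴴ * E.basis)ᴴ := by
    rw [Matrix.conjTranspose_mul, Matrix.conjTranspose_conjTranspose]
  rw [overlap, overlap, this, Matrix.conjTranspose_apply, norm_star]

theorem sum_overlap (D : Diagonalization A) (E : Diagonalization B) (i : d) :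
    ∑ j, D.overlap E i j = 1 := by
  have h : D.basisᴴ * E.basis * (D.basisᴴ * E.basis)ᴴ = 1 := by
    rw [Matrix.conjTranspose_mul, Matrix.conjTranspose_conjTranspose, Matrix.mul_assoc,
      ← Matrix.mul_assoc E.basis, E.mul_conjTranspose, Matrix.one_mul, D.conjTranspose_mul]
  have := Matrix.re_mul_conjTranspose_apply (D.basisᴴ * E.basis) i
  rw [h] at this
  simpa [overlap] using this.symm

theorem re_trace_mul_mul_conjTranspose (D : Diagonalization A) (E : Diagonalization B)
    (X : Matrix d d ℂ) : (A * (X * Xᴴ)).trace.re =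
      ∑ i, D.ev i * ∑ j, ‖(D.basisᴴ * X * E.basis) i j‖ ^ 2 := by
  have h : (A * (X * Xᴴ)).trace = (Matrix.diagonal (fun i => (D.ev i : ℂ)) *
      ((D.basisᴴ * X * E.basis) * (D.basisᴴ * X * E.basis)ᴴ)).trace := by
    have e : (D.basisᴴ * X * E.basis) * (D.basisᴴ * X * E.basis)ᴴ =
        D.basisᴴ * (X * Xᴴ) * D.basis := by
      rw [Matrix.conjTranspose_mul, Matrix.conjTranspose_mul, Matrix.conjTranspose_conjTranspose,
        Matrix.mul_assoc (D.basisᴴ * X), ← Matrix.mul_assoc E.basis, E.mul_conjTranspose,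
        Matrix.one_mul]
      simp only [Matrix.mul_assoc]
    rw [congrArg (fun B => (B * (X * Xᴴ)).trace) D.eq, e, Matrix.mul_assoc, Matrix.mul_assoc,
      Matrix.trace_mul_comm]
    simp only [Matrix.mul_assoc]
  rw [h, Matrix.trace, Complex.re_sum]
  refine Finset.sum_congr rfl fun i _ => ?_
  rw [Matrix.diag_apply, Matrix.diagonal_mul, Complex.re_ofReal_mul,
    Matrix.re_mul_conjTranspose_apply]

/-- The diagonal entries of `A` in the eigenbasis of `E`. -/
theorem re_conj_apply_self (D : Diagonalization A) (E : Diagonalization B) (j : d) :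
    ((E.basisᴴ * A * E.basis) j j).re = ∑ i, D.ev i * D.overlap E i j := by
  have h : E.basisᴴ * A * E.basis = (E.basisᴴ * D.basis) * Matrix.diagonal (fun i => (D.ev i : ℂ)) *
      (E.basisᴴ * D.basis)ᴴ := by
    rw [congrArg (fun B => E.basisᴴ * B * E.basis) D.eq, Matrix.conjTranspose_mul,
      Matrix.conjTranspose_conjTranspose]
    simp only [Matrix.mul_assoc]
  rw [h, Matrix.mul_apply, Complex.re_sum]
  refine Finset.sum_congr rfl fun i _ => ?_
  rw [Matrix.mul_diagonal, Matrix.conjTranspose_apply, mul_right_comm, Complex.star_def,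
    Complex.mul_conj, ← Complex.ofReal_mul, Complex.ofReal_re, Complex.normSq_eq_norm_sq, mul_comm,
    ← overlap_comm]
  rfl

theorem re_conj_apply_self_eq_ev (E : Diagonalization B) (j : d) :
    ((E.basisᴴ * B * E.basis) j j).re = E.ev j := by
  have h : E.basisᴴ * B * E.basis = Matrix.diagonal fun i => (E.ev i : ℂ) := by
    calc E.basisᴴ * B * E.basis = (E.basisᴴ * E.basis) *
        Matrix.diagonal (fun i => (E.ev i : ℂ)) * (E.basisᴴ * E.basis) := by
          conv_lhs => rw [congrArg (fun B => E.basisᴴ * B * E.basis) E.eq]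
          simp only [Matrix.mul_assoc]
      _ = _ := by rw [E.conjTranspose_mul, Matrix.one_mul, Matrix.mul_one]
  rw [h, Matrix.diagonal_apply_eq, Complex.ofReal_re]

/-- The **Nussbaum–Szkoła bound**: the error of a binary test between `A` and `c • B` is at least
half the error of the classical test between their Nussbaum–Szkoła distributions. -/
theorem half_sum_overlap_mul_min_le (D : Diagonalization A) (E : Diagonalization B)
    (hA : A.PosSemidef) (hB : B.PosSemidef) (hD : ∀ i, 0 ≤ D.ev i) (hE : ∀ j, 0 ≤ E.ev j)
    {M : Matrix d d ℂ} (hM : M.PosSemidef) (hM' : (1 - M).PosSemidef) {c : ℝ} (hc : 0 ≤ c) :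
    (∑ i, ∑ j, D.overlap E i j * min (D.ev i) (c * E.ev j)) / 2 ≤
      (A * (1 - M)).trace.re + c * (B * M).trace.re := by
  have hMH : Mᴴ = M := hM.isHermitian
  have hMH' : (1 - M)ᴴ = 1 - M := hM'.isHermitian
  -- This yields `M² ≤ M` and `(1 - M)² ≤ 1 - M`, so both errors may be bounded below with the
  -- squares, which are sums of squared matrix entries.
  have hMM : (M * (1 - M)).PosSemidef := by
    have e : M * (1 - M) = M * (1 - M) * Mᴴ + (1 - M) * M * (1 - M)ᴴ := by
      rw [hMH, hMH']; noncomm_ring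
    rw [e]
    exact (hM'.mul_mul_conjTranspose_same M).add (hM.mul_mul_conjTranspose_same (1 - M))
  have h1 : (A * ((1 - M) * (1 - M)ᴴ)).trace.re ≤ (A * (1 - M)).trace.re := by
    have e : A * (1 - M) = A * ((1 - M) * (1 - M)ᴴ) + A * (M * (1 - M)) := by
      rw [hMH']; noncomm_ring
    rw [e, Matrix.trace_add, Complex.add_re]
    exact le_add_of_nonneg_right (hA.re_trace_mul_nonneg hMM)
  have h2 : (B * (M * Mᴴ)).trace.re ≤ (B * M).trace.re := by
    have e : B * M = B * (M * Mᴴ) + B * (M * (1 - M)) := by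
      rw [hMH]; noncomm_ring
    rw [e, Matrix.trace_add, Complex.add_re]
    exact le_add_of_nonneg_right (hB.re_trace_mul_nonneg hMM)
  refine le_trans ?_ (add_le_add h1 (mul_le_mul_of_nonneg_left h2 hc))
  rw [D.re_trace_mul_mul_conjTranspose E, E.re_trace_mul_mul_conjTranspose D]
  simp only [Finset.mul_sum]
  rw [Finset.sum_comm (γ := d) (α := d) (s := Finset.univ) (t := Finset.univ)
    (f := fun i j => c * (E.ev i * ‖(E.basisᴴ * M * D.basis) i j‖ ^ 2)),
    ← Finset.sum_add_distrib, Finset.sum_div]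
  refine Finset.sum_le_sum fun i _ => ?_
  rw [← Finset.sum_add_distrib, Finset.sum_div]
  refine Finset.sum_le_sum fun j _ => ?_
  have hconj : ‖(E.basisᴴ * M * D.basis) j i‖ = ‖(D.basisᴴ * M * E.basis) i j‖ := by
    have : E.basisᴴ * M * D.basis = (D.basisᴴ * M * E.basis)ᴴ := by
      simp only [Matrix.conjTranspose_mul, Matrix.conjTranspose_conjTranspose, hMH,
        Matrix.mul_assoc]
    rw [this, Matrix.conjTranspose_apply, norm_star]
  -- The overlap amplitude splits into a rejecting and an accepting part; `|x + y|² ≤ 2|x|² + 2|y|²`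
  -- is the source of the factor one half.
  have hsum : (D.basisᴴ * E.basis) i j =
      (D.basisᴴ * (1 - M) * E.basis) i j + (D.basisᴴ * M * E.basis) i j := by
    rw [← Matrix.add_apply, ← Matrix.add_mul, ← Matrix.mul_add, sub_add_cancel, Matrix.mul_one]
  rw [hconj, overlap, hsum]
  set x := (D.basisᴴ * (1 - M) * E.basis) i j
  set y := (D.basisᴴ * M * E.basis) i j
  have hxy : ‖x + y‖ ^ 2 / 2 ≤ ‖x‖ ^ 2 + ‖y‖ ^ 2 := by
    have := pow_le_pow_left₀ (norm_nonneg _) (norm_add_le x y) 2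
    nlinarith [sq_nonneg (‖x‖ - ‖y‖)]
  have hm0 : 0 ≤ min (D.ev i) (c * E.ev j) := le_min (hD i) (mul_nonneg hc (hE j))
  calc ‖x + y‖ ^ 2 * min (D.ev i) (c * E.ev j) / 2
      = ‖x + y‖ ^ 2 / 2 * min (D.ev i) (c * E.ev j) := by ring
    _ ≤ (‖x‖ ^ 2 + ‖y‖ ^ 2) * min (D.ev i) (c * E.ev j) := by gcongr
    _ = min (D.ev i) (c * E.ev j) * ‖x‖ ^ 2 + min (D.ev i) (c * E.ev j) * ‖y‖ ^ 2 := by ring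
    _ ≤ D.ev i * ‖x‖ ^ 2 + c * E.ev j * ‖y‖ ^ 2 := by
      gcongr
      exacts [min_le_left _ _, min_le_right _ _]
    _ = _ := by ring

/-- The relative entropy `∑ r_i |⟨i|j⟩|² (log r_i - log t_j)` in terms of two spectral
decompositions. -/
def relEntropy (D : Diagonalization A) (E : Diagonalization B) : ℝ :=
  ∑ i, ∑ j, D.ev i * D.overlap E i j * (Real.logb 2 (D.ev i) - Real.logb 2 (E.ev j))

/-- A lower bound for the classical testing error by the relative entropy. -/
theorem one_sub_relEntropy_div_le (D : Diagonalization A) (E : Diagonalization B)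
    (hD : ∀ i, 0 ≤ D.ev i) (hE : ∀ j, 0 ≤ E.ev j) (hD₁ : ∑ i, D.ev i = 1) (hE₁ : ∑ j, E.ev j = 1)
    (hDE : ∀ i j, E.ev j = 0 → D.ev i * D.overlap E i j = 0) {γ : ℝ} (hγ : 0 < γ) :
    1 - (D.relEntropy E + (Real.log 2)⁻¹) / γ ≤
      ∑ i, ∑ j, D.overlap E i j * min (D.ev i) (2 ^ γ * E.ev j) := by
  have hlog2 : 0 < Real.log 2 := Real.log_pos one_lt_two
  -- Markov's inequality for the log-likelihood ratio. If `r > 2^γ t`, the ratio exceeds `γ`.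
  -- Otherwise the minimum is `r` and the left side vanishes; the ratio may be negative, but `ln
  -- (t/r) ≤ t/r` compensates it at a total cost of `1 / ln 2`.
  have hpt : ∀ i j, D.ev i * D.overlap E i j * γ - D.overlap E i j *
      min (D.ev i) (2 ^ γ * E.ev j) * γ ≤
      D.ev i * D.overlap E i j * (Real.logb 2 (D.ev i) - Real.logb 2 (E.ev j)) +
        (Real.log 2)⁻¹ * (E.ev j * D.overlap E i j) := by
    intro i j
    have hr := hD i
    have ht := hE j
    have hc := D.overlap_nonneg E i j
    have hac := hDE i j
    set r := D.ev i
    set t := E.ev j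
    set c := D.overlap E i j
    have hmin : 0 ≤ min r (2 ^ γ * t) := le_min hr (by positivity)
    rcases (mul_nonneg hr hc).eq_or_lt with h0 | hpos
    · rw [← h0]
      have h1 : 0 ≤ c * min r (2 ^ γ * t) * γ := by positivity
      have h2 : 0 ≤ (Real.log 2)⁻¹ * (t * c) := by positivity
      linarith
    have hr' : 0 < r := lt_of_le_of_ne hr fun h => by simp [← h] at hpos
    have ht' : 0 < t := lt_of_le_of_ne ht fun h => hpos.ne' (hac h.symm)
    rcases le_or_gt r (2 ^ γ * t) with h | h
    · rw [min_eq_left h]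
      have hl : Real.log t - Real.log r ≤ t / r := by
        rw [← Real.log_div ht'.ne' hr'.ne']
        linarith [Real.log_le_sub_one_of_pos (div_pos ht' hr')]
      have e : r * c * (Real.logb 2 r - Real.logb 2 t) + (Real.log 2)⁻¹ * (t * c) =
          (Real.log 2)⁻¹ * (r * c) * (t / r - (Real.log t - Real.log r)) := by
        simp only [Real.logb]
        field_simp
        ring
      rw [e]
      have : 0 ≤ (Real.log 2)⁻¹ * (r * c) * (t / r - (Real.log t - Real.log r)) :=
        mul_nonneg (by positivity) (sub_nonneg.mpr hl)
      linarith
    · have hl : γ ≤ Real.logb 2 r - Real.logb 2 t := by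
        rw [← Real.logb_div hr'.ne' ht'.ne', Real.le_logb_iff_rpow_le one_lt_two (by positivity),
          le_div_iff₀ ht']
        exact h.le
      have h1 := mul_le_mul_of_nonneg_left hl hpos.le
      have h2 : 0 ≤ c * min r (2 ^ γ * t) * γ := by positivity
      have h3 : 0 ≤ (Real.log 2)⁻¹ * (t * c) := by positivity
      linarith
  have hsum := Finset.sum_le_sum fun i (_ : i ∈ Finset.univ) =>
    Finset.sum_le_sum fun j (_ : j ∈ Finset.univ) => hpt i j
  simp only [Finset.sum_sub_distrib, Finset.sum_add_distrib, ← Finset.sum_mul, ← Finset.mul_sum,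
    sum_overlap, mul_one, hD₁, one_mul] at hsum
  have hQ : ∑ i, ∑ j, E.ev j * D.overlap E i j = 1 := by
    rw [Finset.sum_comm]
    simp only [← Finset.mul_sum, ← overlap_comm D E, sum_overlap, mul_one, hE₁]
  rw [hQ, mul_one] at hsum
  rw [sub_le_iff_le_add, ← sub_le_iff_le_add', le_div_iff₀ hγ, sub_mul, one_mul]
  exact hsum

theorem overlap_tensor {m : ℕ} {X Y : Fin m → Matrix d d ℂ} (D : ∀ j, Diagonalization (X j))
    (E : ∀ j, Diagonalization (Y j)) (i k : Fin m → d) :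
    (tensor D).overlap (tensor E) i k = ∏ j, (D j).overlap (E j) (i j) (k j) := by
  have : (tensor D).basisᴴ * (tensor E).basis =
      tensorProd fun j => (D j).basisᴴ * (E j).basis := by
    simp only [tensor]
    rw [tensorProd_conjTranspose, tensorProd_mul]
  rw [overlap, this]
  simp [tensorProd, overlap, Finset.prod_pow]

/-- The log-likelihood ratio of a product is a sum, and its expectation under product weights is
additive. Logarithms split only where no factor vanishes; by `hDE` the weight is zero elsewhere. -/
theorem relEntropy_tensor {m : ℕ} {X Y : Fin m → Matrix d d ℂ} (D : ∀ j, Diagonalization (X j))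
    (E : ∀ j, Diagonalization (Y j)) (hD₁ : ∀ j, ∑ i, (D j).ev i = 1)
    (hDE : ∀ j i k, (E j).ev k = 0 → (D j).ev i * (D j).overlap (E j) i k = 0) :
    (tensor D).relEntropy (tensor E) = ∑ j, (D j).relEntropy (E j) := by
  have h := sum_prod_weights_mul_sum
    (fun j (z : d × d) => (D j).ev z.1 * (D j).overlap (E j) z.1 z.2)
    (fun j z => Real.logb 2 ((D j).ev z.1) - Real.logb 2 ((E j).ev z.2)) fun j => by
      rw [Fintype.sum_prod_type]
      simp only [← Finset.mul_sum, sum_overlap, mul_one, hD₁]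
  simp only [Fintype.sum_prod_type] at h
  simp only [relEntropy]
  rw [← h, ← (Equiv.arrowProdEquivProdArrow (Fin m) (fun _ => d) (fun _ => d)).symm.sum_comp,
    Fintype.sum_prod_type]
  refine Finset.sum_congr rfl fun i _ => Finset.sum_congr rfl fun k _ => ?_
  change (∏ j, (D j).ev (i j)) * (tensor D).overlap (tensor E) i k *
    (Real.logb 2 (∏ j, (D j).ev (i j)) - Real.logb 2 (∏ j, (E j).ev (k j))) =
    (∏ j, (D j).ev (i j) * (D j).overlap (E j) (i j) (k j)) *
      ∑ j, (Real.logb 2 ((D j).ev (i j)) - Real.logb 2 ((E j).ev (k j)))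
  rw [overlap_tensor, ← Finset.prod_mul_distrib]
  by_cases h0 : ∏ j, (D j).ev (i j) * (D j).overlap (E j) (i j) (k j) = 0
  · rw [h0, zero_mul, zero_mul]
  · have h1 : ∀ j, (D j).ev (i j) * (D j).overlap (E j) (i j) (k j) ≠ 0 := fun j =>
      Finset.prod_ne_zero_iff.mp h0 j (Finset.mem_univ j)
    rw [Real.logb_prod _ _ fun j _ => left_ne_zero_of_mul (h1 j),
      Real.logb_prod _ _ fun j _ => fun he => h1 j (hDE j _ _ he), Finset.sum_sub_distrib]

end Diagonalization

/-! ### The Holevo quantity as a mean relative entropy. -/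

section Holevo

variable {b κ : Type*} [Fintype b] [DecidableEq b] [Fintype κ]

/-- Both sides are the `k`-th diagonal entry of `τ` in its own eigenbasis, which is linear in the
state. -/
theorem sum_mul_sum_ev_mul_overlap {p : κ → ℝ} (σ : κ → QState b) (τ : QState b)
    (hτ : τ.matrix = ∑ w, (p w : ℂ) • (σ w).matrix) (k : b) :
    ∑ w, p w * ∑ i, (σ w).diagonalization.ev i *
      (σ w).diagonalization.overlap τ.diagonalization i k = τ.diagonalization.ev k := by
  simp only [← Diagonalization.re_conj_apply_self]
  rw [← τ.diagonalization.re_conj_apply_self_eq_ev,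
    congrArg (fun X => ((τ.diagonalization.basisᴴ * X * τ.diagonalization.basis) k k).re) hτ]
  simp [Matrix.mul_sum, Matrix.sum_mul, Matrix.sum_apply]

/-- A state of positive weight in a mixture has its support inside that of the mixture: nonnegative
terms with sum zero vanish. -/
theorem ev_mul_overlap_eq_zero {p : κ → ℝ} (hp : ∀ w, 0 < p w) (σ : κ → QState b) (τ : QState b)
    (hτ : τ.matrix = ∑ w, (p w : ℂ) • (σ w).matrix) (w : κ) (i k : b)
    (hk : τ.diagonalization.ev k = 0) :
    (σ w).diagonalization.ev i * (σ w).diagonalization.overlap τ.diagonalization i k = 0 := by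
  have h := sum_mul_sum_ev_mul_overlap σ τ hτ k
  have h0 : ∀ w i, 0 ≤ (σ w).diagonalization.ev i *
      (σ w).diagonalization.overlap τ.diagonalization i k := fun w i =>
    mul_nonneg ((σ w).ev_nonneg i) (Diagonalization.overlap_nonneg _ _ _ _)
  rw [hk, Finset.sum_eq_zero_iff_of_nonneg fun w _ =>
    mul_nonneg (hp w).le (Finset.sum_nonneg fun i _ => h0 w i)] at h
  have h1 := (mul_eq_zero.mp (h w (Finset.mem_univ w))).resolve_left (hp w).ne'
  rw [Finset.sum_eq_zero_iff_of_nonneg fun i _ => h0 w i] at h1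
  exact h1 i (Finset.mem_univ i)

/-- The Holevo quantity is the average relative entropy to the average state. -/
theorem sum_mul_relEntropy_eq {p : κ → ℝ} (σ : κ → QState b) (τ : QState b)
    (hτ : τ.matrix = ∑ w, (p w : ℂ) • (σ w).matrix) :
    ∑ w, p w * (σ w).diagonalization.relEntropy τ.diagonalization =
      τ.entropy - ∑ w, p w * (σ w).entropy := by
  have h1 : ∀ w, (σ w).diagonalization.relEntropy τ.diagonalization = -(σ w).entropy -
      ∑ k, (∑ i, (σ w).diagonalization.ev i *
        (σ w).diagonalization.overlap τ.diagonalization i k) *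
        Real.logb 2 (τ.diagonalization.ev k) := by
    intro w
    simp only [Diagonalization.relEntropy, mul_sub, Finset.sum_sub_distrib, Finset.sum_mul]
    congr 1
    · rw [QState.entropy_eq, neg_neg]
      refine Finset.sum_congr rfl fun i _ => ?_
      rw [← Finset.sum_mul, ← Finset.mul_sum, Diagonalization.sum_overlap, mul_one]
    · exact Finset.sum_comm
  simp only [h1, mul_sub, Finset.sum_sub_distrib, Finset.mul_sum, mul_neg, Finset.sum_neg_distrib]
  rw [Finset.sum_comm]
  simp only [← mul_assoc, ← Finset.sum_mul, sum_mul_sum_ev_mul_overlap σ τ hτ]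
  rw [τ.entropy_eq]
  ring

end Holevo

/-! ### The converse at a fixed block length. -/

section Converse

variable {ι a b : Type*} [Fintype a] [DecidableEq a] [Fintype b] [DecidableEq b]

/-- The uniform distribution on `Fin N`. -/
def uniformSimplex {N : ℕ} (hN : 0 < N) : stdSimplex ℝ (Fin N) :=
  ⟨fun _ => (N : ℝ)⁻¹, fun _ => by positivity, by
    have : (N : ℝ) ≠ 0 := by positivity
    simp [this]⟩

theorem tensorDiag_ev_mul_overlap_eq_zero {m : ℕ} {σ τ : Fin m → QState b}
    (h : ∀ j i k, (τ j).diagonalization.ev k = 0 →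
      (σ j).diagonalization.ev i * (σ j).diagonalization.overlap (τ j).diagonalization i k = 0)
    (i k : Fin m → b) (hk : (tensorDiag τ).ev k = 0) :
    (tensorDiag σ).ev i * (tensorDiag σ).overlap (tensorDiag τ) i k = 0 := by
  rw [tensorDiag_ev] at hk ⊢
  obtain ⟨j, -, hj⟩ := Finset.prod_eq_zero_iff.mp hk
  rw [tensorDiag, tensorDiag, Diagonalization.overlap_tensor, ← Finset.prod_mul_distrib]
  exact Finset.prod_eq_zero (Finset.mem_univ j) (h j _ _ hj)

/-- A lower bound on the error probability of a code, given a bound on the Holevo quantity of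
uniform ensembles of input states. -/
theorem QCode.le_error_add (Φ : QChannel a b) (ρ : ι → QState a) {C : ℝ}
    (hC : ∀ (N : ℕ) (hN : 0 < N) (x : Fin N → ι),
      holevoInfo Φ (fun w => ρ (x w)) (uniformSimplex hN) ≤ C)
    {m N : ℕ} (c : QCode ι b m N) (hN : 0 < N) {γ : ℝ} (hγ : 0 < γ) :
    (1 - (m * C + (Real.log 2)⁻¹) / γ) / 2 ≤ c.error Φ ρ + 2 ^ γ / N := by
  have hN' : (0 : ℝ) < N := by exact_mod_cast hN
  set p := uniformSimplex hN
  set σ : Fin N → Fin m → QState b := fun w j => Φ.apply (ρ (c.word w j)) with hσ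
  -- The reference state is the product of the position-wise averages, not the average codeword;
  -- this makes the bound single-letter.
  set τ : Fin m → QState b := fun j => Φ.apply (QState.mix p fun w => ρ (c.word w j))
  have hτ : ∀ j, (τ j).matrix = ∑ w, (p w : ℂ) • (σ w j).matrix := fun j =>
    Φ.apply_mix_matrix p fun w => ρ (c.word w j)
  have hac : ∀ w j i k, (τ j).diagonalization.ev k = 0 → (σ w j).diagonalization.ev i *
      (σ w j).diagonalization.overlap (τ j).diagonalization i k = 0 := fun w j i k hk =>
    ev_mul_overlap_eq_zero (fun w => inv_pos.mpr hN') (fun w => σ w j) (τ j) (hτ j) w i k hk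
  have hrel : ∀ w, (tensorDiag (σ w)).relEntropy (tensorDiag τ) =
      ∑ j, (σ w j).diagonalization.relEntropy (τ j).diagonalization := fun w =>
    Diagonalization.relEntropy_tensor _ _ (fun j => (σ w j).sum_ev) (hac w)
  have hw : ∀ w, (1 - ((tensorDiag (σ w)).relEntropy (tensorDiag τ) + (Real.log 2)⁻¹) / γ) / 2 ≤
      (1 - (tensorProd (fun j => (σ w j).matrix) * c.decoder.op w).trace.re) +
        2 ^ γ * (tensorProd (fun j => (τ j).matrix) * c.decoder.op w).trace.re := by
    intro w
    have hM' : (1 - c.decoder.op w).PosSemidef := by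
      rw [← c.decoder.sum_eq_one, ← Finset.add_sum_erase _ _ (Finset.mem_univ w),
        add_sub_cancel_left]
      exact Matrix.posSemidef_sum _ fun v _ => c.decoder.posSemidef v
    have h1 := (tensorDiag (σ w)).half_sum_overlap_mul_min_le (tensorDiag τ)
      (posSemidef_tensorProd _) (posSemidef_tensorProd _) (tensorDiag_ev_nonneg _)
      (tensorDiag_ev_nonneg _) (c.decoder.posSemidef w) hM' (Real.rpow_pos_of_pos two_pos γ).le
    have h2 := (tensorDiag (σ w)).one_sub_relEntropy_div_le (tensorDiag τ)
      (tensorDiag_ev_nonneg _) (tensorDiag_ev_nonneg _) (sum_tensorDiag_ev _)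
      (sum_tensorDiag_ev _) (tensorDiag_ev_mul_overlap_eq_zero (hac w)) hγ
    rw [Matrix.mul_sub, Matrix.mul_one, Matrix.trace_sub, trace_tensorProd, Complex.sub_re,
      Complex.one_re] at h1
    linarith
  -- A reference state independent of the message is accepted with probability `1/N` on average.
  have hq : ∑ w, (tensorProd (fun j => (τ j).matrix) * c.decoder.op w).trace.re = 1 := by
    rw [← Complex.re_sum, ← Matrix.trace_sum, ← Finset.mul_sum, c.decoder.sum_eq_one,
      Matrix.mul_one, trace_tensorProd, Complex.one_re]
  have hχ : (N : ℝ)⁻¹ * ∑ w, (tensorDiag (σ w)).relEntropy (tensorDiag τ) ≤ m * C := by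
    simp only [hrel]
    rw [Finset.sum_comm, Finset.mul_sum]
    refine (Finset.sum_le_sum fun j _ => ?_).trans (by simp : ∑ j : Fin m, C ≤ m * C)
    rw [Finset.mul_sum]
    refine le_trans (le_of_eq ?_) (hC N hN fun w => c.word w j)
    exact sum_mul_relEntropy_eq (p := p) (fun w => σ w j) (τ j) (hτ j)
  have hsum := mul_le_mul_of_nonneg_left (Finset.sum_le_sum fun w (_ : w ∈ Finset.univ) => hw w)
    (inv_pos.mpr hN').le
  rw [Finset.sum_add_distrib, ← Finset.mul_sum, hq, mul_add] at hsum
  rw [QCode.error_eq]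
  have hl : (N : ℝ)⁻¹ * ∑ w, (1 - ((tensorDiag (σ w)).relEntropy (tensorDiag τ) +
      (Real.log 2)⁻¹) / γ) / 2 = (1 - ((N : ℝ)⁻¹ * ∑ w, (tensorDiag (σ w)).relEntropy
        (tensorDiag τ) + (Real.log 2)⁻¹) / γ) / 2 := by
    rw [← Finset.sum_div, Finset.sum_sub_distrib, ← Finset.sum_div, Finset.sum_add_distrib]
    simp only [Finset.sum_const, Finset.card_univ, Fintype.card_fin, nsmul_eq_mul]
    field_simp
  rw [hl] at hsum
  refine le_trans ?_ (hsum.trans (le_of_eq ?_))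
  · gcongr
  · simp only [hσ]
    ring

end Converse

/-! ### Merging letters and bounding the ensemble size. -/

section Holevo

variable {a b : Type*} [Fintype a] [Fintype b] [DecidableEq b]

theorem QState.ext_matrix {a : Type*} [Fintype a] {σ τ : QState a} (h : σ.matrix = τ.matrix) :
    σ = τ := by
  cases σ; cases τ; cases h; rfl

theorem holevoInfo_congr {κ κ' : Type*} [Fintype κ] [Fintype κ'] (Φ : QChannel a b)
    {ρ : κ → QState a} {ρ' : κ' → QState a} {p : stdSimplex ℝ κ} {p' : stdSimplex ℝ κ'}
    (h₁ : ∑ i, (p i : ℂ) • (Φ.apply (ρ i)).matrix = ∑ i, (p' i : ℂ) • (Φ.apply (ρ' i)).matrix)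
    (h₂ : ∑ i, p i * (Φ.apply (ρ i)).entropy = ∑ i, p' i * (Φ.apply (ρ' i)).entropy) :
    holevoInfo Φ ρ p = holevoInfo Φ ρ' p' := by
  have h : Φ.apply (QState.mix p ρ) = Φ.apply (QState.mix p' ρ') :=
    QState.ext_matrix ((Φ.apply_mix_matrix p ρ).trans (h₁.trans (Φ.apply_mix_matrix p' ρ').symm))
  rw [holevoInfo, holevoInfo, h, h₂]

theorem holevoInfo_of_unique {κ : Type*} [Fintype κ] [Unique κ] (Φ : QChannel a b)
    (ρ : κ → QState a) (p : stdSimplex ℝ κ) : holevoInfo Φ ρ p = 0 := by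
  have hp : p default = 1 := by
    have := p.2.2
    rwa [Fintype.sum_unique] at this
  have h : Φ.apply (QState.mix p ρ) = Φ.apply (ρ default) := by
    refine QState.ext_matrix ?_
    rw [Φ.apply_mix_matrix, Fintype.sum_unique, hp, Complex.ofReal_one, one_smul]
  rw [holevoInfo, h, Fintype.sum_unique, hp, one_mul, sub_self]

theorem sum_map_smul {κ κ' : Type*} [Fintype κ] [Fintype κ'] {V : Type*} [AddCommGroup V]
    [Module ℝ V] (p : stdSimplex ℝ κ) (e : κ → κ') (F : κ' → V) :
    ∑ k, stdSimplex.map e p k • F k = ∑ i, p i • F (e i) := by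
  classical
  simp only [stdSimplex.map_coe, FunOnFinite.linearMap_apply_apply, Finset.sum_smul]
  rw [← Finset.sum_fiberwise_of_maps_to (t := Finset.univ) (g := e) fun _ _ => Finset.mem_univ _]
  refine Finset.sum_congr rfl fun k _ => Finset.sum_congr (by ext; simp) fun i hi => ?_
  rw [(Finset.mem_filter.mp hi).2]

/-- Repeated letters may be merged. This compares the ensemble of letters at one position of a code
with distributions on the alphabet. -/
theorem holevoInfo_map {κ κ' : Type*} [Fintype κ] [Fintype κ'] (Φ : QChannel a b)
    (ρ : κ' → QState a) (p : stdSimplex ℝ κ) (e : κ → κ') :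
    holevoInfo Φ ρ (stdSimplex.map e p) = holevoInfo Φ (fun i => ρ (e i)) p := by
  refine holevoInfo_congr Φ ?_ ?_
  · have := sum_map_smul p e fun k => (Φ.apply (ρ k)).matrix
    simpa only [Complex.coe_smul] using this
  · simpa only [smul_eq_mul] using sum_map_smul p e fun k => (Φ.apply (ρ k)).entropy

/-- By Carathéodory's theorem, ensembles of bounded size suffice. -/
theorem exists_holevoInfo_eq_fin [Nonempty (QState a)] (Φ : QChannel a b) {n : ℕ}
    (ρ : Fin n → QState a) (p : stdSimplex ℝ (Fin n)) :
    ∃ (ρ' : Fin (Module.finrank ℝ (Matrix b b ℂ × ℝ) + 1) → QState a) (p' : stdSimplex ℝ _),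
      holevoInfo Φ ρ p = holevoInfo Φ ρ' p' := by
  classical
  -- The Holevo information depends only on the average of these points, a convex combination in a
  -- finite-dimensional real space.
  set z : QState a → Matrix b b ℂ × ℝ := fun σ => ((Φ.apply σ).matrix, (Φ.apply σ).entropy)
  have hmem : ∑ i, p i • z (ρ i) ∈ convexHull ℝ (Set.range z) :=
    (convex_convexHull ℝ _).sum_mem (fun i _ => p.2.1 i) p.2.2
      fun i _ => subset_convexHull ℝ _ ⟨_, rfl⟩
  obtain ⟨κ, _, y, w, hy, hind, hw, hw₁, hsum⟩ := eq_pos_convex_span_of_mem_convexHull hmem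
  have hcard : Fintype.card κ ≤ Fintype.card (Fin (Module.finrank ℝ (Matrix b b ℂ × ℝ) + 1)) := by
    rw [Fintype.card_fin]
    exact hind.card_le_finrank_succ.trans (Nat.succ_le_succ (Submodule.finrank_le _))
  obtain ⟨e⟩ := Function.Embedding.nonempty_of_card_le hcard
  choose τ hτ using fun i => hy ⟨i, rfl⟩
  set q : stdSimplex ℝ κ := ⟨w, fun i => (hw i).le, hw₁⟩
  -- The ensemble is padded to the full size with arbitrary states of weight zero.
  refine ⟨Function.extend e τ fun _ => Classical.arbitrary _, stdSimplex.map e q, ?_⟩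
  rw [holevoInfo_map]
  simp only [e.injective.extend_apply]
  have hpq : ∑ i, p i • z (ρ i) = ∑ i, q i • z (τ i) := by
    rw [← hsum]
    exact Finset.sum_congr rfl fun i _ => by rw [hτ]; rfl
  refine holevoInfo_congr Φ ?_ ?_
  · simpa only [Prod.fst_sum, Prod.smul_fst, z, ← Complex.coe_smul] using congrArg Prod.fst hpq
  · simpa only [Prod.snd_sum, Prod.smul_snd, smul_eq_mul, z] using congrArg Prod.snd hpq

end Holevo

/-! ### From one-shot bounds to the capacity. -/

section Threshold

variable {ι a b : Type*} [Fintype a] [DecidableEq a] [Fintype b] [DecidableEq b]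

/-- If small values are eventually available, they can be chosen along a null sequence. -/
theorem exists_tendsto_zero_of_eventually {X : ℕ → Type*} [∀ m, Nonempty (X m)]
    (f : ∀ m, X m → ℝ) (hf : ∀ m x, 0 ≤ f m x) (h : ∀ ε > 0, ∀ᶠ m in atTop, ∃ x, f m x < ε) :
    ∃ x : ∀ m, X m, Tendsto (fun m => f m (x m)) atTop (𝓝 0) := by
  have hbdd : ∀ m, BddBelow (Set.range (f m)) := fun m => ⟨0, by rintro _ ⟨x, rfl⟩; exact hf m x⟩
  -- The infimum over codes need not be attained, so a choice within `1/(m+1)` of it is made.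
  have hex : ∀ m : ℕ, ∃ x, f m x < (⨅ x, f m x) + 1 / ((m : ℝ) + 1) := fun m =>
    exists_lt_of_ciInf_lt (lt_add_of_pos_right _ Nat.one_div_pos_of_nat)
  choose x hx using hex
  refine ⟨x, ?_⟩
  have hinf : Tendsto (fun m => ⨅ x, f m x) atTop (𝓝 0) := by
    rw [Metric.tendsto_nhds]
    intro ε hε
    filter_upwards [h ε hε] with m ⟨y, hy⟩
    rw [Real.dist_0_eq_abs, abs_of_nonneg (Real.iInf_nonneg (hf m))]
    exact (ciInf_le (hbdd m) y).trans_lt hy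
  refine squeeze_zero (fun m => hf m _) (fun m => (hx m).le) ?_
  simpa using hinf.add tendsto_one_div_add_atTop_nhds_zero_nat

theorem QCode.nonempty [Nonempty ι] {m N : ℕ} (hN : 0 < N) : Nonempty (QCode ι b m N) := by
  classical
  refine ⟨⟨fun _ _ => Classical.arbitrary ι, fun w => if w = ⟨0, hN⟩ then 1 else 0,
    fun w => ?_, ?_⟩⟩
  · split_ifs
    exacts [Matrix.PosSemidef.one, Matrix.PosSemidef.zero]
  · simp

theorem exists_pos_le_error (Φ : QChannel a b) (ρ : ι → QState a) {C : ℝ} (hC₀ : 0 ≤ C)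
    (hC : ∀ (N : ℕ) (hN : 0 < N) (x : Fin N → ι),
      holevoInfo Φ (fun w => ρ (x w)) (uniformSimplex hN) ≤ C) {R : ℝ} (hR : C < R) :
    ∃ δ > 0, ∀ᶠ m : ℕ in atTop, ∀ (N : ℕ) (c : QCode ι b m N),
      (2 : ℝ) ^ ((m : ℝ) * R) ≤ N → δ ≤ c.error Φ ρ := by
  -- In `QCode.le_error_add` take `γ = m G`: then `m C / γ = C / G < 1`, while `2^γ / N ≤
  -- 2^{-m(R-G)}` tends to zero. The error is thus at least `L - o(1)`.
  set G := (C + R) / 2 with hG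
  have hG0 : 0 < G := by linarith
  set L := (1 - C / G) / 2
  have hL : 0 < L := by
    have : C / G < 1 := (div_lt_one hG0).mpr (by linarith)
    simp only [L]; linarith
  refine ⟨L / 2, by positivity, ?_⟩
  have hlim : Tendsto (fun m : ℕ => (1 - (C + (Real.log 2)⁻¹ / m) / G) / 2 -
      ((2 : ℝ) ^ (G - R)) ^ m) atTop (𝓝 L) := by
    have h1 : Tendsto (fun m : ℕ => (Real.log 2)⁻¹ / m) atTop (𝓝 0) :=
      tendsto_const_div_atTop_nhds_zero_nat _
    have h2 := tendsto_pow_atTop_nhds_zero_of_lt_one (r := (2 : ℝ) ^ (G - R))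
      (by positivity) (Real.rpow_lt_one_of_one_lt_of_neg one_lt_two (by linarith))
    simpa [L] using ((((h1.const_add C).div_const G).const_sub 1).div_const 2).sub h2
  filter_upwards [hlim.eventually_const_lt (half_lt_self hL), eventually_gt_atTop 0]
    with m hm hm0 N c hN
  have hN' : (0 : ℝ) < N := (Real.rpow_pos_of_pos two_pos _).trans_le hN
  have hm' : (0 : ℝ) < m := by exact_mod_cast hm0
  have h := c.le_error_add Φ ρ hC (by exact_mod_cast hN') (mul_pos hm' hG0)
  have e1 : (m * C + (Real.log 2)⁻¹) / (m * G) = (C + (Real.log 2)⁻¹ / m) / G := by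
    field_simp
  have e2 : (2 : ℝ) ^ (m * G) / N ≤ ((2 : ℝ) ^ (G - R)) ^ m := by
    rw [div_le_iff₀ hN', ← Real.rpow_natCast, ← Real.rpow_mul two_pos.le]
    calc (2 : ℝ) ^ (m * G) = 2 ^ ((G - R) * m) * 2 ^ (m * R) := by
          rw [← Real.rpow_add two_pos]; congr 1; ring
      _ ≤ _ := by gcongr
  rw [e1] at h
  linarith

theorem codingThreshold_of_bounds [Nonempty ι] (Φ : QChannel a b) (ρ : ι → QState a) {C : ℝ}
    (hdir : ∀ R < C, ∀ ε > 0, ∀ᶠ m : ℕ in atTop,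
      ∃ c : QCode ι b m ⌈(2 : ℝ) ^ ((m : ℝ) * R)⌉₊, c.error Φ ρ < ε)
    (hC : ∀ (N : ℕ) (hN : 0 < N) (x : Fin N → ι),
      holevoInfo Φ (fun w => ρ (x w)) (uniformSimplex hN) ≤ C) :
    CodingThreshold Φ ρ C := by
  -- An ensemble with one state has Holevo information zero.
  have hC₀ : 0 ≤ C := by
    have := hC 1 one_pos fun _ => Classical.arbitrary ι
    rwa [holevoInfo_of_unique] at this
  have hconv : ∀ R : ℝ, C < R → _ := fun R hR => exists_pos_le_error Φ ρ hC₀ hC hR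
  refine ⟨fun R hR => ⟨?_, fun hRC => ?_⟩, fun R hR => ?_, hconv⟩
  · rintro ⟨N, c, hN, hc⟩
    by_contra! hRC
    obtain ⟨δ, hδ, hev⟩ := hconv ((C + R) / 2) (by linarith)
    obtain ⟨m, h1, h2, h3, hm⟩ := (hev.and ((hN.eventually_const_lt
      (show (C + R) / 2 < R by linarith)).and ((hc.eventually_lt_const hδ).and
        (eventually_gt_atTop 0)))).exists
    have hm' : (0 : ℝ) < m := by exact_mod_cast hm
    rw [lt_div_iff₀ hm'] at h2
    have hpos : 0 < (N m : ℝ) := by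
      -- A code without messages would have rate `logb 2 0 = 0`, below the positive number `(C + R)
      -- / 2`.
      rcases Nat.eq_zero_or_pos (N m) with h0 | h0
      · rw [h0, Nat.cast_zero, Real.logb_zero] at h2
        nlinarith
      · exact_mod_cast h0
    refine absurd h3 (not_lt.mpr (h1 _ (c m) ?_))
    rw [← Real.le_logb_iff_rpow_le one_lt_two hpos]
    linarith
  · have : ∀ m, Nonempty (Σ N, QCode ι b m N) := fun m =>
      ⟨⟨1, (QCode.nonempty one_pos).some⟩⟩
    -- The number of messages is part of the choice, and the maximum drives rate defect and error to
    -- zero together. Codes of rate `R - ε/2 < C` exist even when `R = C`.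
    obtain ⟨x, hx⟩ := exists_tendsto_zero_of_eventually
      (X := fun m => Σ N, QCode ι b m N)
      (fun m x => max |Real.logb 2 x.1 / m - R| (x.2.error Φ ρ))
      (fun m x => (abs_nonneg _).trans (le_max_left _ _)) fun ε hε => by
        filter_upwards [hdir (R - ε / 2) (by linarith) ε hε, eventually_gt_atTop 0,
          (tendsto_one_div_atTop_nhds_zero_nat (𝕜 := ℝ)).eventually_lt_const hε]
          with m ⟨c, hc⟩ hm0 hm
        refine ⟨⟨_, c⟩, max_lt ?_ hc⟩
        have hm' : (0 : ℝ) < m := by exact_mod_cast hm0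
        set y : ℝ := 2 ^ ((m : ℝ) * (R - ε / 2)) with hy
        have hy0 : 0 < y := by positivity
        have hN0 : (0 : ℝ) < ⌈y⌉₊ := by exact_mod_cast Nat.ceil_pos.mpr hy0
        have hlow : m * (R - ε / 2) ≤ Real.logb 2 ⌈y⌉₊ := by
          rw [Real.le_logb_iff_rpow_le one_lt_two hN0]
          exact Nat.le_ceil _
        have hup : Real.logb 2 ⌈y⌉₊ ≤ 1 + m * R := by
          rw [Real.logb_le_iff_le_rpow one_lt_two hN0, Real.rpow_add two_pos, Real.rpow_one]
          have h1 : y ≤ 2 ^ (m * R) :=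
            Real.rpow_le_rpow_of_exponent_le one_le_two (by gcongr; linarith)
          -- Since `R ≥ 0`, `⌈y⌉ ≤ y + 1 ≤ 2 · 2^{mR}`: rounding up costs at most one bit.
          have h2 : (1 : ℝ) ≤ 2 ^ (m * R) := Real.one_le_rpow one_le_two (by positivity)
          linarith [(Nat.ceil_lt_add_one hy0.le)]
        have h1 : R - ε / 2 ≤ Real.logb 2 ⌈y⌉₊ / m := by
          rw [le_div_iff₀ hm']; linarith
        have h2 : Real.logb 2 ⌈y⌉₊ / m ≤ 1 / m + R := by
          rw [div_le_iff₀ hm', add_mul, div_mul_cancel₀ _ hm'.ne']; linarith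
        rw [abs_lt]
        constructor <;> linarith
    refine ⟨fun m => (x m).1, fun m => (x m).2, ?_, ?_⟩
    · rw [tendsto_iff_dist_tendsto_zero]
      exact squeeze_zero (fun _ => dist_nonneg) (fun m => le_max_left _ _) hx
    · exact squeeze_zero (fun m => QCode.error_nonneg _ Φ ρ) (fun m => le_max_right _ _) hx
  · have : ∀ m : ℕ, Nonempty (QCode ι b m ⌈(2 : ℝ) ^ ((m : ℝ) * R)⌉₊) := fun m =>
      QCode.nonempty (Nat.ceil_pos.mpr (by positivity))
    exact exists_tendsto_zero_of_eventually
      (X := fun m => QCode ι b m ⌈(2 : ℝ) ^ ((m : ℝ) * R)⌉₊) (fun m c => c.error Φ ρ)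
      (fun m c => c.error_nonneg Φ ρ) fun ε hε => hdir R hR ε hε

end Threshold

/-! ### Continuity of the entropy and of the Holevo information. -/

section Continuity

theorem QChannel.continuous_map {a b : Type*} [Fintype a] [Fintype b] (Φ : QChannel a b) :
    Continuous Φ.map :=
  LinearMap.continuous_of_finiteDimensional _

variable {a b : Type*} [Fintype a] [DecidableEq a] [Fintype b] [DecidableEq b]

theorem Diagonalization.fn_pow {d : Type*} [Fintype d] [DecidableEq d] {A : Matrix d d ℂ}
    (D : Diagonalization A) (f : d → ℝ) (k : ℕ) : D.fn f ^ k = D.fn fun i => f i ^ k := by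
  induction k with
  | zero => simp [D.fn_one]
  | succ k ih => simp only [pow_succ, ih, D.fn_mul]

theorem QState.re_trace_pow (σ : QState b) (k : ℕ) :
    (σ.matrix ^ k).trace.re = ∑ i, σ.diagonalization.ev i ^ k := by
  rw [congrArg (fun X => (X ^ k).trace.re) σ.diagonalization.eq_fn, Diagonalization.fn_pow,
    Diagonalization.trace_fn, Complex.ofReal_re]

/-- The von Neumann entropy is continuous. -/
theorem QState.continuous_entropy {X : Type*} [TopologicalSpace X] {σ : X → QState b}
    (hσ : Continuous fun x => (σ x).matrix) : Continuous fun x => (σ x).entropy := by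
  refine continuous_of_uniform_approx_of_continuous fun u hu => ?_
  obtain ⟨ε, hε, hu⟩ := Metric.mem_uniformity_dist.mp hu
  have hh : Continuous fun t : ℝ => t * Real.logb 2 t := by
    have : (fun t : ℝ => t * Real.logb 2 t) = fun t => t * Real.log t / Real.log 2 := by
      ext t; rw [Real.logb, mul_div_assoc]
    rw [this]
    exact Real.continuous_mul_log.div_const _
  -- Weierstrass approximation of `t log t` on `[0, 1]`. The sum of a polynomial over the
  -- eigenvalues is a combination of traces of powers, so continuity of individual eigenvalues is
  -- not needed. The `+ 1` keeps the final estimate strict and the denominator nonzero.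
  obtain ⟨q, hq⟩ := exists_polynomial_near_of_continuousOn 0 1 _ hh.continuousOn
    (ε / (Fintype.card b + 1)) (by positivity)
  refine ⟨fun x => -∑ k ∈ Finset.range (q.natDegree + 1), q.coeff k *
    ((σ x).matrix ^ k).trace.re, ?_, fun x => hu ?_⟩
  · exact (continuous_finsetSum _ fun k _ => continuous_const.mul
      (Complex.continuous_re.comp (hσ.pow k).matrix_trace)).neg
  · have e : ∑ k ∈ Finset.range (q.natDegree + 1), q.coeff k * ((σ x).matrix ^ k).trace.re =
        ∑ i, q.eval ((σ x).diagonalization.ev i) := by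
      simp only [QState.re_trace_pow, Finset.mul_sum, Polynomial.eval_eq_sum_range]
      exact Finset.sum_comm
    beta_reduce
    rw [e, QState.entropy_eq, dist_neg_neg, Real.dist_eq, ← Finset.sum_sub_distrib]
    refine (Finset.abs_sum_le_sum_abs _ _).trans_lt ?_
    have : ∀ i ∈ Finset.univ, |(σ x).diagonalization.ev i *
        Real.logb 2 ((σ x).diagonalization.ev i) - q.eval ((σ x).diagonalization.ev i)| ≤
        ε / (Fintype.card b + 1) := fun i _ => by
      rw [abs_sub_comm]
      exact (hq _ ⟨(σ x).ev_nonneg i, (σ x).ev_le_one i⟩).le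
    refine (Finset.sum_le_sum this).trans_lt ?_
    rw [Finset.sum_const, Finset.card_univ, nsmul_eq_mul, mul_div_assoc',
      div_lt_iff₀ (by positivity)]
    nlinarith

end Continuity

section HolevoContinuity

variable {a b : Type*} [Fintype a] [Fintype b] [DecidableEq b]

theorem continuous_holevoInfo {X κ : Type*} [TopologicalSpace X] [Fintype κ] (Φ : QChannel a b)
    {ρ : X → κ → QState a} {p : X → stdSimplex ℝ κ}
    (hρ : ∀ i, Continuous fun x => (ρ x i).matrix) (hp : Continuous p) :
    Continuous fun x => holevoInfo Φ (ρ x) (p x) := by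
  have hpi : ∀ i, Continuous fun x => p x i := fun i =>
    (continuous_apply i).comp (continuous_subtype_val.comp hp)
  have hΦ : ∀ i, Continuous fun x => (Φ.apply (ρ x i)).matrix := fun i =>
    Φ.continuous_map.comp (hρ i)
  refine (QState.continuous_entropy ?_).sub (continuous_finsetSum _ fun i _ =>
    (hpi i).mul (QState.continuous_entropy (hΦ i)))
  simp only [QChannel.apply_mix_matrix]
  exact continuous_finsetSum _ fun i _ =>
    (Complex.continuous_ofReal.comp (hpi i)).smul (hΦ i)

theorem exists_isGreatest_holevoInfo {n : ℕ} (hn : 0 < n) (Φ : QChannel a b)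
    (ρ : Fin n → QState a) :
    ∃ C, IsGreatest (Set.range fun p : stdSimplex ℝ (Fin n) => holevoInfo Φ ρ p) C := by
  have : CompactSpace (stdSimplex ℝ (Fin n)) :=
    isCompact_iff_compactSpace.mp (isCompact_stdSimplex ℝ (Fin n))
  have hc : Continuous fun p : stdSimplex ℝ (Fin n) => holevoInfo Φ ρ p :=
    continuous_holevoInfo Φ (fun _ => continuous_const) continuous_id
  exact (isCompact_range hc).exists_isGreatest ⟨_, uniformSimplex hn, rfl⟩

end HolevoContinuity

/-! ### Compactness of the state space and existence of the maximum in (b). -/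

section Maxima

variable {a b : Type*} [Fintype a] [DecidableEq a] [Fintype b] [DecidableEq b]

/-- The sum of all squared entries is `Tr σ² = ∑ λ² ≤ ∑ λ = 1`. -/
theorem QState.norm_matrix_apply_le_one (σ : QState a) (i j : a) : ‖σ.matrix i j‖ ≤ 1 := by
  have h1 : (σ.matrix * σ.matrixᴴ).trace.re = ∑ i, σ.diagonalization.ev i ^ 2 := by
    rw [σ.posSemidef.isHermitian.eq, ← sq, σ.re_trace_pow]
  have h2 : (σ.matrix * σ.matrixᴴ).trace.re = ∑ i, ∑ j, ‖σ.matrix i j‖ ^ 2 := by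
    rw [Matrix.trace, Complex.re_sum]
    exact Finset.sum_congr rfl fun i _ => Matrix.re_mul_conjTranspose_apply σ.matrix i
  have h3 : ∑ i, σ.diagonalization.ev i ^ 2 ≤ 1 := by
    rw [← σ.sum_ev]
    refine Finset.sum_le_sum fun i _ => ?_
    nlinarith [σ.ev_nonneg i, σ.ev_le_one i]
  have h4 : ‖σ.matrix i j‖ ^ 2 ≤ ∑ i, ∑ j, ‖σ.matrix i j‖ ^ 2 :=
    (Finset.single_le_sum (f := fun j => ‖σ.matrix i j‖ ^ 2) (fun _ _ => by positivity)
      (Finset.mem_univ j)).trans (Finset.single_le_sum (f := fun i => ∑ j, ‖σ.matrix i j‖ ^ 2)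
        (fun _ _ => Finset.sum_nonneg fun _ _ => by positivity) (Finset.mem_univ i))
  rw [← sq_le_one_iff₀ (norm_nonneg _)]
  linarith

theorem isCompact_setOf_posSemidef_trace_eq_one :
    IsCompact {X : Matrix a a ℂ | X.PosSemidef ∧ X.trace = 1} := by
  have hK : IsCompact (Set.pi Set.univ fun _ : a => Set.pi Set.univ fun _ : a =>
      Metric.closedBall (0 : ℂ) 1) :=
    isCompact_univ_pi fun _ => isCompact_univ_pi fun _ => isCompact_closedBall _ _
  refine IsCompact.of_isClosed_subset hK ?_ fun X hX i _ j _ => ?_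
  · simp only [Matrix.posSemidef_iff_dotProduct_mulVec, Set.ofPred_and, Set.ofPred_forall]
    refine IsClosed.inter (IsClosed.inter ?_ (isClosed_iInter fun x => ?_)) ?_
    · exact isClosed_eq continuous_id.matrix_conjTranspose continuous_id
    · exact isClosed_le continuous_const
        (continuous_const.dotProduct (continuous_id.matrix_mulVec continuous_const))
    · exact isClosed_eq continuous_id.matrix_trace continuous_const
  · rw [mem_closedBall_zero_iff]
    exact QState.norm_matrix_apply_le_one ⟨X, hX.1, hX.2⟩ i j

theorem QState.nonempty_of_nonempty [Nonempty a] : Nonempty (QState a) := by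
  let i : a := Classical.arbitrary a
  refine ⟨⟨Matrix.diagonal (Pi.single i 1), Matrix.PosSemidef.diagonal ?_, ?_⟩⟩
  · exact Pi.single_nonneg.mpr zero_le_one
  · rw [Matrix.trace_diagonal]; simp

/-- By Carathéodory one ensemble size `d` realizes every value, so the set is the continuous image
of a single compact space. -/
theorem exists_isGreatest_holevoInfo_all [Nonempty a] (Φ : QChannel a b) :
    ∃ C, IsGreatest {x : ℝ | ∃ (n : ℕ) (ρ : Fin n → QState a) (p : stdSimplex ℝ (Fin n)),
      x = holevoInfo Φ ρ p} C := by
  have hne : Nonempty (QState a) := QState.nonempty_of_nonempty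
  set d := Module.finrank ℝ (Matrix b b ℂ × ℝ) + 1
  set S := {X : Matrix a a ℂ | X.PosSemidef ∧ X.trace = 1}
  have : CompactSpace S := isCompact_iff_compactSpace.mp isCompact_setOf_posSemidef_trace_eq_one
  have : CompactSpace (stdSimplex ℝ (Fin d)) :=
    isCompact_iff_compactSpace.mp (isCompact_stdSimplex ℝ (Fin d))
  let st : S → QState a := fun X => ⟨X, X.2.1, X.2.2⟩
  have hc : Continuous fun x : (Fin d → S) × stdSimplex ℝ (Fin d) =>
      holevoInfo Φ (fun i => st (x.1 i)) x.2 :=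
    continuous_holevoInfo Φ (fun i => continuous_subtype_val.comp
      ((continuous_apply i).comp continuous_fst)) continuous_snd
  obtain ⟨σ⟩ := hne
  have hr : {x : ℝ | ∃ (n : ℕ) (ρ : Fin n → QState a) (p : stdSimplex ℝ (Fin n)),
      x = holevoInfo Φ ρ p} = Set.range fun x : (Fin d → S) × stdSimplex ℝ (Fin d) =>
        holevoInfo Φ (fun i => st (x.1 i)) x.2 := by
    ext x
    constructor
    · rintro ⟨n, ρ, p, rfl⟩
      have : Nonempty (QState a) := ⟨σ⟩
      obtain ⟨ρ', p', h⟩ := exists_holevoInfo_eq_fin Φ ρ p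
      exact ⟨(fun i => ⟨(ρ' i).matrix, (ρ' i).posSemidef, (ρ' i).trace_eq_one⟩, p'), h.symm⟩
    · rintro ⟨x, rfl⟩
      exact ⟨d, _, x.2, rfl⟩
  rw [hr]
  exact (isCompact_range hc).exists_isGreatest ⟨_, (fun _ => ⟨σ.matrix, σ.posSemidef,
    σ.trace_eq_one⟩, uniformSimplex (Nat.succ_pos _)), rfl⟩

end Maxima

theorem mainTheorem1 {a b : Type*} [Fintype a] [DecidableEq a] [Nonempty a]
    [Fintype b] [DecidableEq b] (Φ : QChannel a b) :
    (∀ (n : ℕ) (ρ : Fin n → QState a), 0 < n →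
      ∃ C : ℝ, IsGreatest (Set.range fun p : stdSimplex ℝ (Fin n) => holevoInfo Φ ρ p) C ∧
        CodingThreshold Φ ρ C) ∧
    (∃ C : ℝ, IsGreatest {x : ℝ | ∃ (n : ℕ) (ρ : Fin n → QState a) (p : stdSimplex ℝ (Fin n)),
          x = holevoInfo Φ ρ p} C ∧
        CodingThreshold Φ (fun σ : QState a => σ) C) := by
  constructor
  · intro n ρ hn
    obtain ⟨C, hC⟩ := exists_isGreatest_holevoInfo hn Φ ρ
    have : Nonempty (Fin n) := ⟨⟨0, hn⟩⟩
    refine ⟨C, hC, codingThreshold_of_bounds Φ ρ (fun R hR ε hε => ?_) fun N hN x => ?_⟩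
    · obtain ⟨p, rfl⟩ := hC.1
      exact eventually_exists_code Φ ρ p hR hε
    · rw [← holevoInfo_map]
      exact hC.2 ⟨_, rfl⟩
  · obtain ⟨C, hC⟩ := exists_isGreatest_holevoInfo_all Φ
    have : Nonempty (QState a) := QState.nonempty_of_nonempty
    refine ⟨C, hC, codingThreshold_of_bounds Φ _ (fun R hR ε hε => ?_) fun N hN x => ?_⟩
    · obtain ⟨n, ρ, p, rfl⟩ := hC.1
      filter_upwards [eventually_exists_code Φ ρ p hR hε] with m ⟨c, hc⟩
      -- A code over an optimal finite ensemble is also a code over the alphabet of all states.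
      exact ⟨⟨fun w j => ρ (c.word w j), c.decoder⟩, hc⟩
    · exact hC.2 ⟨N, x, _, rfl⟩

end
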